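/- Let $\mathsf{HA}$ be intuitionistic first-order arithmetic with equality, with function symbols for all primitive recursive functions and logical constants $\forall,\exists,\to,\land,\lor,\bot$ ($\neg\varphi$ is $\varphi\to\bot$), and let $\mathsf{PA}$ be $\mathsf{HA}$ plus the law of excluded middle. $\mathrm{FV}(\varphi)$ is the set of free variables of $\varphi$. Let $\Sigma_0=\Pi_0$ be the class of quantifier-free formulas; $\Sigma_{k+1}$ is the class of formulas $\exists \overline{x}\,\psi$ with $\psi\in\Pi_k$, and $\Pi_{k+1}$ is the class of formulas $\forall \overline{x}\,\psi$ with $\psi\in\Sigma_k$, where $\overline{x}$ is a non-empty list of variables. The finite set $\mathrm{Alt}(\varphi)$ of alternation paths (finite alternating sequences of $+$ and $-$) is $\{\langle\rangle\}$ for quantifier-free $\varphi$. Otherwise $\mathrm{Alt}(\neg\varphi_1)=\{s^\perp : s\in \mathrm{Alt}(\varphi_1)\}$, where $s^\perp$ is $s$ with $+$ and $-$ interchanged; $\mathrm{Alt}(\varphi_1\land\varphi_2)=\mathrm{Alt}(\varphi_1\lor\varphi_2)=\mathrm{Alt}(\varphi_1)\cup\mathrm{Alt}(\varphi_2)$; $\mathrm{Alt}(\varphi_1\to\varphi_2)=\{s^\perp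 : s\in \mathrm{Alt}(\varphi_1)\}\cup\mathrm{Alt}(\varphi_2)$ (if $\varphi_2$ is not $\bot$); and $\mathrm{Alt}(\forall x\varphi_1)$ (resp. $\mathrm{Alt}(\exists x\varphi_1)$) is obtained from $\mathrm{Alt}(\varphi_1)$ by prefixing $-$ (resp. $+$) to every path that does not already begin with it. Let $\mathrm{F}_k$ be the class of formulas whose longest alternation path has length $k$. Put $\mathrm{U}_0=\mathrm{F}_0$, let $\mathrm{U}_{k+1}$ be the class of those formulas in $\mathrm{F}_{k+1}$ all of whose alternation paths of length $k+1$ begin with $-$, and let $\mathrm{U}_k^+=\mathrm{U}_k\cup\bigcup_{i<k}\mathrm{F}_i$. For a class $\Gamma$ of formulas consider the schemata - $\Gamma\text{-}\mathrm{LEM}$: $\forall x(\varphi(x)\lor\neg\varphi(x))$, and $\Gamma\text{-}\mathrm{DNE}$: $\forall x(\neg\neg\varphi(x)\to\varphi(x))$, where $\varphi\in\Gamma$ and $\mathrm{FV}(\varphi)\subseteq\{x\}$; - $\Gamma\text{-}\mathrm{DNS}$: $\forall x\,(\forall y\,\neg\neg\varphi(x,y)\to\neg\neg\forall y\,\varphi(x,y))$,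 where $\varphi\in\Gamma$ and $\mathrm{FV}(\varphi)\subseteq\{x,y\}$. **Theorem.** Let $k$ be a natural number and let $T$ be a theory in the language of $\mathsf{HA}$ that lies in between $\mathsf{HA}+\Pi_{k-2}\text{-}\mathrm{LEM}$ ($\mathsf{HA}$ if $k<2$) and $\mathsf{PA}$, that is, every theorem of the former is a theorem of $T$ and every theorem of $T$ is a theorem of $\mathsf{PA}$. Then $T$ proves all instances of $\Sigma_{k-1}\text{-}\mathrm{DNE}$ (no instances if $k=0$) and of $\mathrm{U}_k^+\text{-}\mathrm{DNS}$ if and only if, for every $k'\le k$ and every $\varphi\in\mathrm{U}_{k'}$, there is $\varphi'\in\Pi_{k'}$ with $\mathrm{FV}(\neg\neg\varphi)=\mathrm{FV}(\varphi')$ and $T\vdash\neg\neg\varphi\leftrightarrow\varphi'$. -/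

import Mathlib

namespace Arith

/-- Function symbols: one for every definition of a primitive recursive function
(by composition and primitive recursion from zero, successor and the projections);
the index is the arity. -/
inductive PRFun : ℕ → Type
  | zero : PRFun 0
  | succ : PRFun 1
  | proj {n : ℕ} (i : Fin n) : PRFun n
  | comp {m n : ℕ} (f : PRFun m) (g : Fin m → PRFun n) : PRFun n
  | prec {n : ℕ} (f : PRFun n) (g : PRFun (n + 2)) : PRFun (n + 1)

/-- Terms; variables are de Bruijn indices. -/
inductive Term : Type
  | var (i : ℕ) : Term
  | app {n : ℕ} (f : PRFun n) (t : Fin n → Term) : Term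

namespace Term

/-- The constant `0`. -/
def zero : Term := app PRFun.zero Fin.elim0

/-- The successor of a term. -/
def succ (t : Term) : Term := app PRFun.succ (fun _ => t)

/-- Simultaneous substitution. -/
def subst (σ : ℕ → Term) : Term → Term
  | var i => σ i
  | app f t => app f (fun j => (t j).subst σ)

/-- The variables of a term. -/
def fv : Term → Set ℕ
  | var i => {i}
  | app _ t => ⋃ j, (t j).fv

end Term

/-- Formulas with all the logical constants primitive. In `all φ` and `ex φ`, the bound
variable is the variable `0` of `φ`, and the variable `i + 1` of `φ` is the variable `i`
outside of the quantifier. -/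
inductive Formula : Type
  | bot : Formula
  | eq (t u : Term) : Formula
  | and (φ ψ : Formula) : Formula
  | or (φ ψ : Formula) : Formula
  | imp (φ ψ : Formula) : Formula
  | all (φ : Formula) : Formula
  | ex (φ : Formula) : Formula

/-- The substitution `σ` moved under a quantifier. -/
def up (σ : ℕ → Term) : ℕ → Term
  | 0 => Term.var 0
  | i + 1 => (σ i).subst (fun j => Term.var (j + 1))

/-- The substitution that replaces the variable `0` by `t` and lowers the other ones. -/
def instSubst (t : Term) : ℕ → Term
  | 0 => t
  | i + 1 => Term.var i

/-- The substitution that replaces the variable `0` by its successor. -/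
def succSubst : ℕ → Term
  | 0 => (Term.var 0).succ
  | i + 1 => Term.var (i + 1)

namespace Formula

/-- Negation is implication of falsity. -/
abbrev neg (φ : Formula) : Formula := imp φ bot

/-- Logical equivalence. -/
abbrev iff (φ ψ : Formula) : Formula := and (imp φ ψ) (imp ψ φ)

/-- Capture-avoiding simultaneous substitution. -/
def subst : (ℕ → Term) → Formula → Formula
  | _, bot => bot
  | σ, eq t u => eq (t.subst σ) (u.subst σ)
  | σ, and φ ψ => and (φ.subst σ) (ψ.subst σ)
  | σ, or φ ψ => or (φ.subst σ) (ψ.subst σ)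
  | σ, imp φ ψ => imp (φ.subst σ) (ψ.subst σ)
  | σ, all φ => all (φ.subst (up σ))
  | σ, ex φ => ex (φ.subst (up σ))

/-- Raise all the free variables by one. -/
def shift (φ : Formula) : Formula := φ.subst (fun i => Term.var (i + 1))

/-- The instance of `φ` at the term `t` for the variable `0`. -/
def inst (φ : Formula) (t : Term) : Formula := φ.subst (instSubst t)

/-- The set of free variables. -/
def fv : Formula → Set ℕ
  | bot => ∅
  | eq t u => t.fv ∪ u.fv
  | and φ ψ => φ.fv ∪ ψ.fv
  | or φ ψ => φ.fv ∪ ψ.fv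
  | imp φ ψ => φ.fv ∪ ψ.fv
  | all φ => {i | i + 1 ∈ φ.fv}
  | ex φ => {i | i + 1 ∈ φ.fv}

/-- Quantifier-free formulas. -/
def QF : Formula → Prop
  | bot => True
  | eq _ _ => True
  | and φ ψ => φ.QF ∧ ψ.QF
  | or φ ψ => φ.QF ∧ ψ.QF
  | imp φ ψ => φ.QF ∧ ψ.QF
  | all _ => False
  | ex _ => False

end Formula

/-- Natural deduction for intuitionistic first-order logic with equality: `Prf T Γ φ` says
that `φ` is derivable from the hypotheses `Γ` and the axioms `T`. Free variables of
axioms are read universally, those of hypotheses are parameters. -/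
inductive Prf (T : Set Formula) : List Formula → Formula → Prop
  | ax {Γ : List Formula} {φ : Formula} : φ ∈ T → Prf T Γ φ
  | hyp {Γ : List Formula} {φ : Formula} : φ ∈ Γ → Prf T Γ φ
  | botE {Γ : List Formula} {φ : Formula} : Prf T Γ Formula.bot → Prf T Γ φ
  | andI {Γ : List Formula} {φ ψ : Formula} :
      Prf T Γ φ → Prf T Γ ψ → Prf T Γ (Formula.and φ ψ)
  | andE₁ {Γ : List Formula} {φ ψ : Formula} : Prf T Γ (Formula.and φ ψ) → Prf T Γ φ
  | andE₂ {Γ : List Formula} {φ ψ : Formula} : Prf T Γ (Formula.and φ ψ) → Prf T Γ ψ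
  | orI₁ {Γ : List Formula} {φ ψ : Formula} : Prf T Γ φ → Prf T Γ (Formula.or φ ψ)
  | orI₂ {Γ : List Formula} {φ ψ : Formula} : Prf T Γ ψ → Prf T Γ (Formula.or φ ψ)
  | orE {Γ : List Formula} {φ ψ χ : Formula} :
      Prf T Γ (Formula.or φ ψ) → Prf T (φ :: Γ) χ → Prf T (ψ :: Γ) χ → Prf T Γ χ
  | impI {Γ : List Formula} {φ ψ : Formula} :
      Prf T (φ :: Γ) ψ → Prf T Γ (Formula.imp φ ψ)
  | impE {Γ : List Formula} {φ ψ : Formula} :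
      Prf T Γ (Formula.imp φ ψ) → Prf T Γ φ → Prf T Γ ψ
  | allI {Γ : List Formula} {φ : Formula} :
      Prf T (Γ.map Formula.shift) φ → Prf T Γ (Formula.all φ)
  | allE {Γ : List Formula} {φ : Formula} (t : Term) :
      Prf T Γ (Formula.all φ) → Prf T Γ (φ.inst t)
  | exI {Γ : List Formula} {φ : Formula} (t : Term) :
      Prf T Γ (φ.inst t) → Prf T Γ (Formula.ex φ)
  | exE {Γ : List Formula} {φ ψ : Formula} :
      Prf T Γ (Formula.ex φ) → Prf T (φ :: Γ.map Formula.shift) ψ.shift → Prf T Γ ψ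
  | eqI {Γ : List Formula} (t : Term) : Prf T Γ (Formula.eq t t)
  | eqE {Γ : List Formula} (φ : Formula) {t u : Term} :
      Prf T Γ (Formula.eq t u) → Prf T Γ (φ.inst t) → Prf T Γ (φ.inst u)

/-- `φ` is provable in the theory with the axioms `T`. -/
def Provable (T : Set Formula) (φ : Formula) : Prop := Prf T [] φ

/-- Every instance of the schema `P` is provable in `T`. -/
def Proves (T P : Set Formula) : Prop := ∀ φ ∈ P, Provable T φ

/-- The non-logical axioms of intuitionistic arithmetic: the successor axioms, the defining
equations of the primitive recursive function symbols, and induction for all formulas. -/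
inductive HAAxiom : Formula → Prop
  | succ_ne_zero (t : Term) : HAAxiom (Formula.neg (Formula.eq t.succ Term.zero))
  | succ_inj (t u : Term) :
      HAAxiom (Formula.imp (Formula.eq t.succ u.succ) (Formula.eq t u))
  | proj {n : ℕ} (i : Fin n) (t : Fin n → Term) :
      HAAxiom (Formula.eq (Term.app (PRFun.proj i) t) (t i))
  | comp {m n : ℕ} (f : PRFun m) (g : Fin m → PRFun n) (t : Fin n → Term) :
      HAAxiom (Formula.eq (Term.app (PRFun.comp f g) t)
        (Term.app f (fun j => Term.app (g j) t)))
  | prec_zero {n : ℕ} (f : PRFun n) (g : PRFun (n + 2)) (t : Fin n → Term) :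
      HAAxiom (Formula.eq
        (Term.app (PRFun.prec f g) (Fin.cons Term.zero t : Fin (n + 1) → Term))
        (Term.app f t))
  | prec_succ {n : ℕ} (f : PRFun n) (g : PRFun (n + 2)) (s : Term) (t : Fin n → Term) :
      HAAxiom (Formula.eq
        (Term.app (PRFun.prec f g) (Fin.cons s.succ t : Fin (n + 1) → Term))
        (Term.app g (Fin.cons s (Fin.cons
          (Term.app (PRFun.prec f g) (Fin.cons s t : Fin (n + 1) → Term)) t :
            Fin (n + 1) → Term) : Fin (n + 2) → Term)))
  | induction (φ : Formula) :
      HAAxiom (Formula.imp (φ.inst Term.zero)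
        (Formula.imp (Formula.all (Formula.imp φ (φ.subst succSubst))) (Formula.all φ)))

/-- Intuitionistic arithmetic. -/
def HA : Set Formula := {φ | HAAxiom φ}

/-- Classical arithmetic: intuitionistic arithmetic with the law of excluded middle. -/
def PA : Set Formula := HA ∪ {χ | ∃ φ : Formula, χ = Formula.or φ φ.neg}

mutual

/-- `Σ_k`: prenex formulas with `k` alternating non-empty blocks of quantifiers, the
outermost one existential. -/
def SigmaClass : ℕ → Set Formula
  | 0 => {φ | φ.QF}
  | k + 1 => {φ | ∃ n : ℕ, ∃ ψ ∈ PiClass k, φ = Formula.ex^[n + 1] ψ}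

/-- `Π_k`: prenex formulas with `k` alternating non-empty blocks of quantifiers, the
outermost one universal. -/
def PiClass : ℕ → Set Formula
  | 0 => {φ | φ.QF}
  | k + 1 => {φ | ∃ n : ℕ, ∃ ψ ∈ SigmaClass k, φ = Formula.all^[n + 1] ψ}

end

/-- The instances `∀ x (φ(x) ∨ ¬ φ(x))` with `φ ∈ G` and no free variable but `x`. -/
def LEM (G : Set Formula) : Set Formula :=
  {χ | ∃ φ ∈ G, φ.fv ⊆ {0} ∧ χ = Formula.all (Formula.or φ φ.neg)}

/-- The instances `∀ x (¬¬ φ(x) → φ(x))` with `φ ∈ G` and no free variable but `x`. -/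
def DNE (G : Set Formula) : Set Formula :=
  {χ | ∃ φ ∈ G, φ.fv ⊆ {0} ∧ χ = Formula.all (Formula.imp φ.neg.neg φ)}

/-- The instances `∀ x (∀ y ¬¬ φ(x, y) → ¬¬ ∀ y φ(x, y))` with `φ ∈ G` and no free variables
but `x` (index `1` in `φ`) and `y` (index `0` in `φ`). -/
def DNS (G : Set Formula) : Set Formula :=
  {χ | ∃ φ ∈ G, φ.fv ⊆ {0, 1} ∧
    χ = Formula.all (Formula.imp (Formula.all φ.neg.neg) (Formula.all φ).neg.neg)}

/-- The symbols of alternation paths. -/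
inductive Sgn : Type
  | plus : Sgn
  | minus : Sgn
  deriving DecidableEq

/-- Interchange of the two symbols. -/
def Sgn.flip : Sgn → Sgn
  | plus => minus
  | minus => plus

/-- The path `s` if it begins with `a`, and the path `a s` otherwise. -/
def prepend (a : Sgn) (s : List Sgn) : List Sgn :=
  if s.head? = some a then s else a :: s

/-- The set of alternation paths of a formula. On quantifier-free formulas the clauses give
the set whose only element is the empty path. -/
def alt : Formula → Finset (List Sgn)
  | Formula.bot => {[]}
  | Formula.eq _ _ => {[]}
  | Formula.and φ ψ => alt φ ∪ alt ψ
  | Formula.or φ ψ => alt φ ∪ alt ψ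
  | Formula.imp φ Formula.bot => (alt φ).image (List.map Sgn.flip)
  | Formula.imp φ ψ => (alt φ).image (List.map Sgn.flip) ∪ alt ψ
  | Formula.all φ => (alt φ).image (prepend Sgn.minus)
  | Formula.ex φ => (alt φ).image (prepend Sgn.plus)

/-- The maximal length of an alternation path. -/
def degree (φ : Formula) : ℕ := (alt φ).sup List.length

/-- `F_k`: the formulas of degree `k`. -/
def FClass (k : ℕ) : Set Formula := {φ | degree φ = k}

/-- `U_k`: the formulas of degree `k` whose alternation paths of length `k` all begin
with `-` (if `k > 0`). -/
def UClass : ℕ → Set Formula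
  | 0 => FClass 0
  | k + 1 => {φ | φ ∈ FClass (k + 1) ∧
      ∀ s ∈ alt φ, s.length = k + 1 → s.head? = some Sgn.minus}

/-- `U_k⁺`: the formulas in `U_k` and those of degree less than `k`. -/
def UPlusClass (k : ℕ) : Set Formula := UClass k ∪ ⋃ i < k, FClass i

/-- The doubly negated formulas `¬¬ φ` with `φ ∈ G`. -/
def dn (G : Set Formula) : Set Formula := {χ | ∃ φ ∈ G, χ = φ.neg.neg}

/-- The prenex normal form statement for `G` and `G'` over the theory `T`. -/
def PNFT (T G G' : Set Formula) : Prop :=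
  ∀ φ ∈ G, ∃ φ' ∈ G', φ.fv = φ'.fv ∧ Provable T (Formula.iff φ φ')

/-- `HA + Π_{k-2}`-LEM, which is `HA` if `k < 2`. -/
def baseTheory (k : ℕ) : Set Formula :=
  HA ∪ {χ | ∃ j : ℕ, j + 2 = k ∧ χ ∈ LEM (PiClass j)}

/-- `Σ_{k-1}`-DNE, which has no instances if `k = 0`. -/
def sigmaPredDNE (k : ℕ) : Set Formula :=
  {χ | ∃ j : ℕ, j + 1 = k ∧ χ ∈ DNE (SigmaClass j)}

end Arith

-- Everything turns on the negative translation `tr ⊥`, which carries classical equivalences over to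
-- any `T` extending intuitionistic arithmetic (`tr_sound`, `eqv_tr_of_eqv_PA`).
--
-- From the schemata to normal forms: a formula `φ` of `U_m`, `m ≤ k`, has a classical prenex form
-- `ψ ∈ Π_m` with the same free variables (`Within.exists_prenex`). Double negation shift makes
-- `¬¬φ` equivalent to the translation of `φ` (`Within.eqv_neg_neg_tr`), because the matrices of all
-- universal subformulas stay in `U_k⁺`. Double negation elimination makes `ψ` equivalent to its own
-- translation (`IsPrenex.eqv_tr_bot`), because the existential subformulas of `ψ` lie below level
-- `k`. So `¬¬φ ↔ tr ⊥ φ ↔ tr ⊥ ψ ↔ ψ` over `T`.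
--
-- From normal forms to double negation elimination, by induction on the level: let `φ ∈ Σ_{m+1}`
-- with `m + 1 < k`. Under a dummy universal quantifier, `φ` falls within the range of the
-- hypothesis, so `¬¬φ` is equivalent over `T` to some `χ ∈ Π_{m+2}`, and classically `χ → φ`. The
-- induction hypothesis and `Π_{k-2}`-LEM make all prenex formulas up to level `m` decidable.
-- Friedman's trick of taking `A := φ` in the translation `tr A` then shows that classical
-- arithmetic is conservative over `T` for implications from `Π_{m+2}` to `Σ_{m+1}`
-- (`conservative_pi_sigma`), whence `¬¬φ → φ`.
--
-- From there to double negation shift: `¬¬φ` and `¬¬∀y φ` are equivalent over `T` to `χ` and `ψ` in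
-- `Π` classes of level at most `k`. Classically `∀y χ ↔ ψ`, and the translation fixes both sides,
-- so the equivalence already holds in `T` (`DNS_of_PNFT`).
--
-- The schemata allow one parameter only. A pairing function developed inside the theory reduces any
-- number of parameters to one (`ExtendsHA.provable_of_component`).

namespace Arith

-- Substitution and free variables

/-- The environment that sends `0` to `t` and `i + 1` to `σ i`. -/
def scons (t : Term) (σ : ℕ → Term) : ℕ → Term
  | 0 => t
  | i + 1 => σ i

infixr:67 " ∷ " => scons

@[simp] theorem scons_zero (t : Term) (σ : ℕ → Term) : (t ∷ σ) 0 = t := rfl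

@[simp] theorem scons_succ (t : Term) (σ : ℕ → Term) (i : ℕ) : (t ∷ σ) (i + 1) = σ i := rfl

@[simp] theorem scons_one (t : Term) (σ : ℕ → Term) : (t ∷ σ) 1 = σ 0 := rfl

@[simp] theorem scons_two (t : Term) (σ : ℕ → Term) : (t ∷ σ) 2 = σ 1 := rfl

@[simp] theorem scons_three (t : Term) (σ : ℕ → Term) : (t ∷ σ) 3 = σ 2 := rfl

namespace Term

@[simp] theorem subst_var (σ : ℕ → Term) (i : ℕ) : (var i).subst σ = σ i := rfl

@[simp] theorem subst_zero (σ : ℕ → Term) : zero.subst σ = zero := by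
  simp only [zero, subst]
  congr 1
  funext j
  exact j.elim0

@[simp] theorem subst_succ (σ : ℕ → Term) (t : Term) : t.succ.subst σ = (t.subst σ).succ := rfl

theorem subst_subst (t : Term) (σ τ : ℕ → Term) :
    (t.subst σ).subst τ = t.subst (fun i => (σ i).subst τ) := by
  induction t with
  | var i => rfl
  | app f t ih => simp only [subst, ih]

theorem subst_id (t : Term) : t.subst var = t := by
  induction t with
  | var i => rfl
  | app f t ih => simp only [subst, ih]

theorem subst_congr {t : Term} {σ τ : ℕ → Term} (h : ∀ i ∈ t.fv, σ i = τ i) :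
    t.subst σ = t.subst τ := by
  induction t with
  | var i => exact h i rfl
  | app f t ih =>
    simp only [subst]
    congr 1
    funext j
    exact ih j fun i hi => h i (Set.mem_iUnion.2 ⟨j, hi⟩)

theorem fv_subst (t : Term) (σ : ℕ → Term) : (t.subst σ).fv = ⋃ i ∈ t.fv, (σ i).fv := by
  induction t with
  | var i => simp [subst, fv]
  | app f t ih =>
    simp only [subst, fv, ih]
    ext x
    simp only [Set.mem_iUnion, exists_prop]
    exact ⟨fun ⟨j, i, hi, hx⟩ => ⟨i, ⟨j, hi⟩, hx⟩, fun ⟨i, ⟨j, hi⟩, hx⟩ => ⟨j, i, hi, hx⟩⟩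

theorem fv_bounded (t : Term) : ∃ N, ∀ i ∈ t.fv, i < N := by
  induction t with
  | var i => exact ⟨i + 1, fun j hj => by obtain rfl : j = i := hj; omega⟩
  | app f t ih =>
    choose N hN using ih
    refine ⟨Finset.univ.sup N, fun i hi => ?_⟩
    obtain ⟨j, hj⟩ := Set.mem_iUnion.1 hi
    exact (hN j i hj).trans_le (Finset.le_sup (Finset.mem_univ j))

end Term

theorem instSubst_eq (t : Term) : instSubst t = t ∷ Term.var := by
  funext i; cases i <;> rfl

theorem up_comp (σ τ : ℕ → Term) :
    (fun i => (up σ i).subst (up τ)) = up (fun i => (σ i).subst τ) := by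
  funext i
  cases i with
  | zero => rfl
  | succ i => simp [up, Term.subst_subst]

theorem up_var : up Term.var = Term.var := by
  funext i; cases i <;> rfl

theorem up_scons (σ : ℕ → Term) (t : Term) (τ : ℕ → Term) :
    (fun i => (up σ i).subst (t ∷ τ)) = t ∷ fun i => (σ i).subst τ := by
  funext i
  cases i with
  | zero => rfl
  | succ i => simp [up, Term.subst_subst]

namespace Formula

theorem subst_subst (φ : Formula) (σ τ : ℕ → Term) :
    (φ.subst σ).subst τ = φ.subst (fun i => (σ i).subst τ) := by
  induction φ generalizing σ τ with
  | bot => rfl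
  | eq t u => simp only [subst, Term.subst_subst]
  | and φ ψ h₁ h₂ | or φ ψ h₁ h₂ | imp φ ψ h₁ h₂ => simp only [subst, h₁, h₂]
  | all φ h | ex φ h => simp only [subst, h, up_comp]

theorem subst_id (φ : Formula) : φ.subst Term.var = φ := by
  induction φ with
  | bot => rfl
  | eq t u => simp only [subst, Term.subst_id]
  | and φ ψ h₁ h₂ | or φ ψ h₁ h₂ | imp φ ψ h₁ h₂ => simp only [subst, h₁, h₂]
  | all φ h | ex φ h => simp only [subst, up_var, h]

theorem subst_congr {φ : Formula} {σ τ : ℕ → Term} (h : ∀ i ∈ φ.fv, σ i = τ i) :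
    φ.subst σ = φ.subst τ := by
  induction φ generalizing σ τ with
  | bot => rfl
  | eq t u =>
    simp only [subst, Term.subst_congr fun i hi => h i (Or.inl hi),
      Term.subst_congr fun i hi => h i (Or.inr hi)]
  | and φ ψ h₁ h₂ | or φ ψ h₁ h₂ | imp φ ψ h₁ h₂ =>
    simp only [subst, h₁ fun i hi => h i (Or.inl hi), h₂ fun i hi => h i (Or.inr hi)]
  | all φ ih | ex φ ih =>
    simp only [subst]
    congr 1
    refine ih fun i hi => ?_
    cases i with
    | zero => rfl
    | succ i => simp only [up, h i hi]

theorem fv_bounded (φ : Formula) : ∃ N, ∀ i ∈ φ.fv, i < N := by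
  induction φ with
  | bot => exact ⟨0, fun i hi => hi.elim⟩
  | eq t u =>
    obtain ⟨N, hN⟩ := t.fv_bounded
    obtain ⟨M, hM⟩ := u.fv_bounded
    exact ⟨max N M, fun i hi => hi.elim (fun h => (hN i h).trans_le (le_max_left _ _))
      fun h => (hM i h).trans_le (le_max_right _ _)⟩
  | and φ ψ h₁ h₂ | or φ ψ h₁ h₂ | imp φ ψ h₁ h₂ =>
    obtain ⟨N, hN⟩ := h₁
    obtain ⟨M, hM⟩ := h₂
    exact ⟨max N M, fun i hi => hi.elim (fun h => (hN i h).trans_le (le_max_left _ _))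
      fun h => (hM i h).trans_le (le_max_right _ _)⟩
  | all φ h | ex φ h =>
    obtain ⟨N, hN⟩ := h
    exact ⟨N, fun i hi => (Nat.lt_succ_self i).trans (hN _ hi)⟩

theorem fv_subst (φ : Formula) (σ : ℕ → Term) : (φ.subst σ).fv = ⋃ i ∈ φ.fv, (σ i).fv := by
  have key : ∀ (φ : Formula) (σ : ℕ → Term),
      (∀ σ, (φ.subst σ).fv = ⋃ i ∈ φ.fv, (σ i).fv) →
      {i | i + 1 ∈ (φ.subst (up σ)).fv} = ⋃ i ∈ {i | i + 1 ∈ φ.fv}, (σ i).fv := by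
    intro φ σ h
    ext x
    simp only [h, Set.mem_iUnion, Set.mem_ofPred_eq, exists_prop]
    constructor
    · rintro ⟨i, hi, hx⟩
      cases i with
      | zero => simp [up, Term.fv] at hx
      | succ i =>
        refine ⟨i, hi, ?_⟩
        simpa [up, Term.fv_subst, Term.fv] using hx
    · rintro ⟨i, hi, hx⟩
      refine ⟨i + 1, hi, ?_⟩
      simpa [up, Term.fv_subst, Term.fv] using hx
  induction φ generalizing σ with
  | bot => simp [subst, fv]
  | eq t u => simp only [subst, fv, Term.fv_subst, Set.biUnion_union]
  | and φ ψ h₁ h₂ | or φ ψ h₁ h₂ | imp φ ψ h₁ h₂ =>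
    simp only [subst, fv, h₁, h₂, Set.biUnion_union]
  | all φ h | ex φ h => exact key φ σ h

theorem inst_subst (φ : Formula) (t : Term) (σ : ℕ → Term) :
    (φ.inst t).subst σ = φ.subst (t.subst σ ∷ σ) := by
  rw [inst, subst_subst, instSubst_eq]
  congr 1
  funext i
  cases i <;> rfl

theorem subst_up_inst (φ : Formula) (t : Term) (σ : ℕ → Term) :
    (φ.subst (up σ)).inst t = φ.subst (t ∷ σ) := by
  rw [inst, subst_subst, instSubst_eq, up_scons]
  simp only [Term.subst_id]

theorem shift_subst_scons (φ : Formula) (t : Term) (σ : ℕ → Term) :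
    φ.shift.subst (t ∷ σ) = φ.subst σ := by
  rw [shift, subst_subst]
  rfl

theorem shift_subst_up (φ : Formula) (σ : ℕ → Term) :
    φ.shift.subst (up σ) = (φ.subst σ).shift := by
  rw [shift, shift, subst_subst, subst_subst]
  rfl

theorem shift_inst (φ : Formula) (t : Term) : φ.shift.inst t = φ := by
  rw [inst, instSubst_eq, shift_subst_scons, subst_id]

theorem mem_fv_shift {φ : Formula} {i : ℕ} : i ∈ φ.shift.fv ↔ ∃ j ∈ φ.fv, i = j + 1 := by
  simp [shift, fv_subst, Term.fv]

theorem succ_mem_fv_shift {φ : Formula} {i : ℕ} : i + 1 ∈ φ.shift.fv ↔ i ∈ φ.fv := by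
  simp [mem_fv_shift]

theorem fv_ex_shift (φ : Formula) : φ.shift.ex.fv = φ.fv :=
  Set.ext fun _ => succ_mem_fv_shift

theorem fv_all_shift (φ : Formula) : φ.shift.all.fv = φ.fv :=
  Set.ext fun _ => succ_mem_fv_shift

end Formula

open Formula

-- Structural properties of derivations

namespace Prf

variable {T : Set Formula} {Γ Δ : List Formula} {φ ψ χ : Formula}

theorem weaken (h : Prf T Γ φ) (hΔ : Γ ⊆ Δ) : Prf T Δ φ := by
  induction h generalizing Δ with
  | ax h => exact .ax h
  | hyp h => exact .hyp (hΔ h)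
  | botE _ ih => exact .botE (ih hΔ)
  | andI _ _ ih₁ ih₂ => exact .andI (ih₁ hΔ) (ih₂ hΔ)
  | andE₁ _ ih => exact .andE₁ (ih hΔ)
  | andE₂ _ ih => exact .andE₂ (ih hΔ)
  | orI₁ _ ih => exact .orI₁ (ih hΔ)
  | orI₂ _ ih => exact .orI₂ (ih hΔ)
  | orE _ _ _ ih ih₁ ih₂ =>
    exact .orE (ih hΔ) (ih₁ (List.cons_subset_cons _ hΔ)) (ih₂ (List.cons_subset_cons _ hΔ))
  | impI _ ih => exact .impI (ih (List.cons_subset_cons _ hΔ))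
  | impE _ _ ih₁ ih₂ => exact .impE (ih₁ hΔ) (ih₂ hΔ)
  | allI _ ih => exact .allI (ih (List.map_subset _ hΔ))
  | allE t _ ih => exact .allE t (ih hΔ)
  | exI t _ ih => exact .exI t (ih hΔ)
  | exE _ _ ih₁ ih₂ =>
    exact .exE (ih₁ hΔ) (ih₂ (List.cons_subset_cons _ (List.map_subset _ hΔ)))
  | eqI t => exact .eqI t
  | eqE φ _ _ ih₁ ih₂ => exact .eqE φ (ih₁ hΔ) (ih₂ hΔ)

theorem allIter (h : Prf T [] φ) (N : ℕ) : Prf T [] (Formula.all^[N] φ) := by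
  induction N generalizing φ with
  | zero => exact h
  | succ N ih => exact ih (.allI h)

theorem inst_allIter {N : ℕ} {τ σ : ℕ → Term} (h : Prf T Γ ((Formula.all^[N] φ).subst τ))
    (hσ : ∀ i, σ (i + N) = τ i) : Prf T Γ (φ.subst σ) := by
  induction N generalizing φ σ with
  | zero =>
    obtain rfl : σ = τ := funext hσ
    exact h
  | succ N ih =>
    have := ih (φ := φ.all) (σ := fun i => σ (i + 1)) h fun i => by rw [← hσ i]; congr 1
    have := Prf.allE (σ 0) this
    rw [subst_up_inst] at this
    convert this using 2
    funext i
    cases i <;> rfl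

theorem fv_allIter (φ : Formula) (N : ℕ) : (Formula.all^[N] φ).fv = {i | i + N ∈ φ.fv} := by
  induction N generalizing φ with
  | zero => rfl
  | succ N ih =>
    rw [Function.iterate_succ_apply, ih]
    rfl

/-- Free variables of theorems are read universally. -/
theorem subst_of_nil (h : Prf T [] φ) (σ : ℕ → Term) : Prf T Γ (φ.subst σ) := by
  obtain ⟨N, hN⟩ := φ.fv_bounded
  refine inst_allIter (N := N) (τ := fun i => σ (i + N)) ?_ fun _ => rfl
  -- The universal closure of `φ` is closed, so substitution leaves it unchanged; the terms of `σ`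
  -- enter by instantiation.
  have hc : (Formula.all^[N] φ).subst (fun i => σ (i + N)) = Formula.all^[N] φ := by
    conv_rhs => rw [← Formula.subst_id (Formula.all^[N] φ)]
    refine subst_congr fun i hi => ?_
    rw [fv_allIter] at hi
    exact absurd (hN _ hi) (by omega)
  rw [hc]
  exact (h.allIter N).weaken (List.nil_subset _)

theorem subst (h : Prf T Γ φ) (σ : ℕ → Term) :
    Prf T (Γ.map (Formula.subst σ)) (φ.subst σ) := by
  have hmap : ∀ (Γ : List Formula) (σ : ℕ → Term),
      (Γ.map Formula.shift).map (Formula.subst (up σ)) =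
        (Γ.map (Formula.subst σ)).map Formula.shift := by
    intro Γ σ
    simp only [List.map_map]
    exact List.map_congr_left fun φ _ => shift_subst_up φ σ
  have hinst : ∀ (φ : Formula) (t : Term) (σ : ℕ → Term),
      (φ.inst t).subst σ = (φ.subst (up σ)).inst (t.subst σ) := by
    intro φ t σ
    rw [inst_subst, subst_up_inst]
  induction h generalizing σ with
  | ax h => exact subst_of_nil (.ax h) σ
  | hyp h => exact .hyp (List.mem_map_of_mem h)
  | botE _ ih => exact .botE (ih σ)
  | andI _ _ ih₁ ih₂ => exact .andI (ih₁ σ) (ih₂ σ)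
  | andE₁ _ ih => exact .andE₁ (ih σ)
  | andE₂ _ ih => exact .andE₂ (ih σ)
  | orI₁ _ ih => exact .orI₁ (ih σ)
  | orI₂ _ ih => exact .orI₂ (ih σ)
  | orE _ _ _ ih ih₁ ih₂ => exact .orE (ih σ) (ih₁ σ) (ih₂ σ)
  | impI _ ih => exact .impI (ih σ)
  | impE _ _ ih₁ ih₂ => exact .impE (ih₁ σ) (ih₂ σ)
  | allI _ ih =>
    have := ih (up σ)
    rw [hmap] at this
    exact .allI this
  | allE t _ ih =>
    rw [hinst]
    exact .allE _ (ih σ)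
  | exI t _ ih =>
    have := ih σ
    rw [hinst] at this
    exact .exI _ this
  | exE _ _ ih₁ ih₂ =>
    have := ih₂ (up σ)
    rw [List.map_cons, hmap, shift_subst_up] at this
    exact .exE (ih₁ σ) this
  | eqI t => exact .eqI _
  | eqE φ _ _ ih₁ ih₂ =>
    have := ih₂ σ
    rw [hinst] at this ⊢
    exact .eqE _ (ih₁ σ) this

theorem exists_fresh (Γ : List Formula) : ∃ N, ∀ φ ∈ Γ, ∀ i ∈ φ.fv, i < N := by
  induction Γ with
  | nil => exact ⟨0, by simp⟩
  | cons φ Γ ih =>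
    obtain ⟨N, hN⟩ := ih
    obtain ⟨M, hM⟩ := φ.fv_bounded
    refine ⟨max N M, fun ψ hψ i hi => ?_⟩
    rcases List.mem_cons.1 hψ with rfl | hψ
    · exact (hM i hi).trans_le (le_max_right _ _)
    · exact (hN ψ hψ i hi).trans_le (le_max_left _ _)

/-- The substitution that turns the variable `N` into the variable `0` and raises the others. -/
def unfresh (N : ℕ) : ℕ → Term := fun i => if i = N then Term.var 0 else Term.var (i + 1)

theorem subst_unfresh {N : ℕ} (h : ∀ i ∈ φ.fv, i < N) : φ.subst (unfresh N) = φ.shift :=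
  subst_congr fun i hi => if_neg (h i hi).ne

theorem map_unfresh {N : ℕ} (h : ∀ φ ∈ Γ, ∀ i ∈ φ.fv, i < N) :
    Γ.map (Formula.subst (unfresh N)) = Γ.map Formula.shift :=
  List.map_congr_left fun φ hφ => subst_unfresh (h φ hφ)

theorem inst_unfresh {N : ℕ} (h : ∀ i ∈ φ.all.fv, i < N) :
    (φ.inst (Term.var N)).subst (unfresh N) = φ := by
  rw [inst_subst]
  conv_rhs => rw [← Formula.subst_id φ]
  refine subst_congr fun i hi => ?_
  cases i with
  | zero => simp [unfresh]
  | succ i => exact if_neg (h i hi).ne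

/-- Among the terms is a variable `N` fresh for `φ` and `Γ`. Renaming it to `0` and raising all
others yields the premise of the introduction rule. -/
theorem all_iff : Prf T Γ φ.all ↔ ∀ t, Prf T Γ (φ.inst t) := by
  refine ⟨fun h t => .allE t h, fun h => ?_⟩
  obtain ⟨N, hN⟩ := exists_fresh (φ.all :: Γ)
  have := (h (Term.var N)).subst (unfresh N)
  rw [map_unfresh fun ψ hψ => hN ψ (List.mem_cons_of_mem _ hψ),
    inst_unfresh (hN _ List.mem_cons_self)] at this
  exact .allI this

theorem ex_elim (h : Prf T Γ φ.ex)
    (hχ : ∀ Δ, Γ ⊆ Δ → ∀ t, Prf T Δ (φ.inst t) → Prf T Δ χ) : Prf T Γ χ := by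
  obtain ⟨N, hN⟩ := exists_fresh (φ.all :: χ :: Γ)
  have := (hχ (φ.inst (Term.var N) :: Γ) (List.subset_cons_self _ _) (Term.var N)
    (.hyp List.mem_cons_self)).subst (unfresh N)
  rw [List.map_cons, inst_unfresh (hN _ List.mem_cons_self),
    map_unfresh fun ψ hψ => hN ψ (List.mem_cons_of_mem _ (List.mem_cons_of_mem _ hψ)),
    subst_unfresh (hN χ (List.mem_cons_of_mem _ List.mem_cons_self))] at this
  exact .exE h this

/-- Lists of hypotheses ordered by inclusion behave like the worlds of a Kripke model. Conjunction,
implication and universal quantification get such clauses as equivalences; disjunction and existence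
only get elimination into a derivability goal, since a list need not decide a disjunct or supply a
witness. -/
theorem imp_iff : Prf T Γ (imp φ ψ) ↔ ∀ Δ, Γ ⊆ Δ → Prf T Δ φ → Prf T Δ ψ :=
  ⟨fun h _ hΔ hφ => .impE (h.weaken hΔ) hφ,
    fun h => .impI (h _ (List.subset_cons_self _ _) (.hyp List.mem_cons_self))⟩

theorem or_elim (h : Prf T Γ (or φ ψ)) (h₁ : ∀ Δ, Γ ⊆ Δ → Prf T Δ φ → Prf T Δ χ)
    (h₂ : ∀ Δ, Γ ⊆ Δ → Prf T Δ ψ → Prf T Δ χ) : Prf T Γ χ :=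
  .orE h (h₁ _ (List.subset_cons_self _ _) (.hyp List.mem_cons_self))
    (h₂ _ (List.subset_cons_self _ _) (.hyp List.mem_cons_self))

theorem and_iff : Prf T Γ (and φ ψ) ↔ Prf T Γ φ ∧ Prf T Γ ψ :=
  ⟨fun h => ⟨.andE₁ h, .andE₂ h⟩, fun h => .andI h.1 h.2⟩

end Prf

-- Derivability in an environment of terms

/-- `φ` is derivable from the hypotheses `Γ` in the environment `σ`. -/
def Holds (T : Set Formula) (Γ : List Formula) (σ : ℕ → Term) (φ : Formula) : Prop :=
  Prf T Γ (φ.subst σ)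

section Holds

variable {T : Set Formula} {Γ Δ : List Formula} {σ τ : ℕ → Term} {φ ψ χ : Formula}

theorem Holds.mono (h : Holds T Γ σ φ) (hΔ : Γ ⊆ Δ) : Holds T Δ σ φ := Prf.weaken h hΔ

theorem Holds.botE (h : Holds T Γ σ bot) : Holds T Γ τ φ := Prf.botE h

theorem holds_eq {t u : Term} :
    Holds T Γ σ (eq t u) ↔ Prf T Γ (eq (t.subst σ) (u.subst σ)) := Iff.rfl

theorem holds_and : Holds T Γ σ (and φ ψ) ↔ Holds T Γ σ φ ∧ Holds T Γ σ ψ := Prf.and_iff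

theorem holds_imp :
    Holds T Γ σ (imp φ ψ) ↔ ∀ Δ, Γ ⊆ Δ → Holds T Δ σ φ → Holds T Δ σ ψ := Prf.imp_iff

theorem Holds.mp (h : Holds T Γ σ (imp φ ψ)) (hφ : Holds T Γ σ φ) : Holds T Γ σ ψ :=
  Prf.impE h hφ

theorem Holds.mp' (h : Holds T Γ σ (imp φ ψ)) (hΔ : Γ ⊆ Δ) (hφ : Holds T Δ σ φ) :
    Holds T Δ σ ψ :=
  (h.mono hΔ).mp hφ

theorem Holds.inl (h : Holds T Γ σ φ) : Holds T Γ σ (or φ ψ) := Prf.orI₁ h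

theorem Holds.inr (h : Holds T Γ σ ψ) : Holds T Γ σ (or φ ψ) := Prf.orI₂ h

theorem Holds.orE (h : Holds T Γ σ (or φ ψ))
    (h₁ : ∀ Δ, Γ ⊆ Δ → Holds T Δ σ φ → Holds T Δ τ χ)
    (h₂ : ∀ Δ, Γ ⊆ Δ → Holds T Δ σ ψ → Holds T Δ τ χ) : Holds T Γ τ χ :=
  Prf.or_elim h h₁ h₂

theorem holds_all : Holds T Γ σ (all φ) ↔ ∀ t, Holds T Γ (t ∷ σ) φ := by
  unfold Holds
  rw [Formula.subst, Prf.all_iff]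
  simp only [subst_up_inst]

theorem Holds.exI (t : Term) (h : Holds T Γ (t ∷ σ) φ) : Holds T Γ σ (ex φ) := by
  unfold Holds at h
  rw [← subst_up_inst] at h
  exact Prf.exI t h

theorem Holds.exE (h : Holds T Γ σ (ex φ))
    (hχ : ∀ Δ, Γ ⊆ Δ → ∀ t, Holds T Δ (t ∷ σ) φ → Holds T Δ τ χ) : Holds T Γ τ χ :=
  Prf.ex_elim h fun Δ hΔ t ht => hχ Δ hΔ t (by rwa [subst_up_inst] at ht)

theorem holds_shift {t : Term} : Holds T Γ (t ∷ σ) φ.shift ↔ Holds T Γ σ φ := by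
  unfold Holds
  rw [shift_subst_scons]

theorem holds_subst : Holds T Γ σ (φ.subst τ) ↔ Holds T Γ (fun i => (τ i).subst σ) φ := by
  unfold Holds
  rw [Formula.subst_subst]

theorem holds_inst {t : Term} : Holds T Γ σ (φ.inst t) ↔ Holds T Γ (t.subst σ ∷ σ) φ := by
  unfold Holds
  rw [inst_subst]

theorem holds_var : Holds T Γ Term.var φ ↔ Prf T Γ φ := by
  unfold Holds
  rw [Formula.subst_id]

theorem provable_iff_holds : Provable T φ ↔ ∀ Γ σ, Holds T Γ σ φ :=
  ⟨fun h _ σ => Prf.subst_of_nil h σ, fun h => holds_var.1 (h [] Term.var)⟩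

theorem Holds.of_provable (h : Provable T φ) : Holds T Γ σ φ := provable_iff_holds.1 h Γ σ

theorem provable_imp_iff :
    Provable T (imp φ ψ) ↔ ∀ Γ σ, Holds T Γ σ φ → Holds T Γ σ ψ := by
  rw [provable_iff_holds]
  exact ⟨fun h Γ σ => (h Γ σ).mp, fun h Γ σ => holds_imp.2 fun Δ _ => h Δ σ⟩

theorem provable_iff_iff :
    Provable T (Formula.iff φ ψ) ↔ ∀ Γ σ, Holds T Γ σ φ ↔ Holds T Γ σ ψ := by
  have : Provable T (Formula.iff φ ψ) ↔ Provable T (imp φ ψ) ∧ Provable T (imp ψ φ) :=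
    Prf.and_iff
  rw [this, provable_imp_iff, provable_imp_iff]
  exact ⟨fun h Γ σ => ⟨h.1 Γ σ, h.2 Γ σ⟩, fun h => ⟨fun Γ σ => (h Γ σ).1, fun Γ σ => (h Γ σ).2⟩⟩

theorem provable_all_iff : Provable T (all φ) ↔ Provable T φ := by
  simp only [provable_iff_holds, holds_all]
  refine ⟨fun h Γ σ => ?_, fun h Γ σ t => h Γ (t ∷ σ)⟩
  convert h Γ (fun i => σ (i + 1)) (σ 0) using 1
  funext i
  cases i <;> rfl

theorem Holds.neg_neg (h : Holds T Γ σ φ) : Holds T Γ σ φ.neg.neg :=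
  holds_imp.2 fun _ hΔ hn => hn.mp (h.mono hΔ)

end Holds

-- Equality and decidability of quantifier-free formulas

/-- `T` proves every theorem of intuitionistic arithmetic. -/
def ExtendsHA (T : Set Formula) : Prop := ∀ φ ∈ HA, Provable T φ

namespace Term

/-- Application of a unary function symbol. -/
def app1 (f : PRFun 1) (t : Term) : Term := app f fun _ => t

/-- Application of a binary function symbol. -/
def app2 (f : PRFun 2) (t u : Term) : Term := app f (Fin.cons t fun _ => u)

@[simp] theorem subst_app1 (f : PRFun 1) (t : Term) (σ : ℕ → Term) :
    (app1 f t).subst σ = app1 f (t.subst σ) := rfl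

@[simp] theorem subst_app2 (f : PRFun 2) (t u : Term) (σ : ℕ → Term) :
    (app2 f t u).subst σ = app2 f (t.subst σ) (u.subst σ) := by
  simp only [app2, subst]
  congr 1
  funext j
  refine Fin.cases ?_ (fun _ => ?_) j <;> rfl

end Term

open Term

namespace Prf

variable {T : Set Formula} {Γ Δ : List Formula} {φ ψ χ : Formula}

theorem eq_rewrite (φ : Formula) {t u : Term} (σ : ℕ → Term) (h : Prf T Γ (eq t u))
    (hφ : Prf T Γ (φ.subst (t ∷ σ))) : Prf T Γ (φ.subst (u ∷ σ)) := by
  rw [← subst_up_inst] at hφ ⊢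
  exact .eqE _ h hφ

theorem eq_symm {t u : Term} (h : Prf T Γ (eq t u)) : Prf T Γ (eq u t) :=
  eq_rewrite (eq (var 0) (var 1)) (t ∷ var) h (.eqI t)

theorem eq_trans {t u v : Term} (h : Prf T Γ (eq t u)) (h' : Prf T Γ (eq u v)) :
    Prf T Γ (eq t v) :=
  eq_rewrite (eq (var 1) (var 0)) (t ∷ var) h' h

theorem eq_app {n : ℕ} (f : PRFun n) {t u : Fin n → Term} (h : ∀ j, Prf T Γ (eq (t j) (u j))) :
    Prf T Γ (eq (app f t) (app f u)) := by
  have key : ∀ m, Prf T Γ (eq (app f t) (app f fun j => if j.1 < m then u j else t j)) := by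
    intro m
    induction m with
    | zero => simpa using Prf.eqI (app f t)
    | succ m ih =>
      by_cases hm : m < n
      · refine ih.eq_trans ?_
        -- Arguments are exchanged one at a time, from the left. Variable `0` marks the place being
        -- rewritten, and variable `i + 1` stands for argument `i` in its present state.
        have := eq_rewrite (T := T) (Γ := Γ) (eq (app f fun j => var (j.1 + 1))
          (app f fun j => if j.1 = m then var 0 else var (j.1 + 1)))
          (fun i => if hi : i < n then if i < m then u ⟨i, hi⟩ else t ⟨i, hi⟩ else var 0)
          (h ⟨m, hm⟩) ?_
        · have hl : (fun j : Fin n => ite (j.1 < m) (u j) (t j)) = fun j : Fin n =>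
              (if hi : j.1 < n then if j.1 < m then u ⟨j, hi⟩ else t ⟨j, hi⟩ else var 0) := by
            simp
          have hr : (fun j : Fin n => ite (j.1 < m + 1) (u j) (t j)) = fun j : Fin n =>
              (if j.1 = m then var 0 else var (j.1 + 1)).subst (u ⟨m, hm⟩ ∷ fun i =>
                if hi : i < n then if i < m then u ⟨i, hi⟩ else t ⟨i, hi⟩ else var 0) := by
            funext j
            rcases lt_trichotomy j.1 m with hj | hj | hj
            · simp [hj, hj.ne, hj.trans (Nat.lt_succ_self m)]
            · obtain rfl : j = ⟨m, hm⟩ := Fin.ext hj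
              simp
            · simp [hj.ne', hj.not_gt, show ¬ j.1 < m + 1 by omega]
          rw [hl, hr]
          exact this
        · have he : (fun j : Fin n => (var (j.1 + 1)).subst (t ⟨m, hm⟩ ∷ fun i =>
                if hi : i < n then if i < m then u ⟨i, hi⟩ else t ⟨i, hi⟩ else var 0)) =
              fun j : Fin n => (if j.1 = m then var 0 else var (j.1 + 1)).subst
                (t ⟨m, hm⟩ ∷ fun i =>
                if hi : i < n then if i < m then u ⟨i, hi⟩ else t ⟨i, hi⟩ else var 0) := by
            funext j
            by_cases hj : j.1 = m
            · obtain rfl : j = ⟨m, hm⟩ := Fin.ext hj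
              simp [hm]
            · simp [hj]
          simp only [Formula.subst, Term.subst] at he ⊢
          rw [he]
          exact .eqI _
      · convert ih using 4 with j
        simp only [show j.1 < m + 1 by omega, show j.1 < m by omega]
  simpa using key n

theorem eq_app1 (f : PRFun 1) {t u : Term} (h : Prf T Γ (eq t u)) :
    Prf T Γ (eq (app1 f t) (app1 f u)) := eq_app f fun _ => h

theorem eq_succ {t u : Term} (h : Prf T Γ (eq t u)) : Prf T Γ (eq t.succ u.succ) :=
  eq_app1 PRFun.succ h

theorem eq_app2 (f : PRFun 2) {t u t' u' : Term} (h : Prf T Γ (eq t u))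
    (h' : Prf T Γ (eq t' u')) : Prf T Γ (eq (app2 f t t') (app2 f u u')) :=
  eq_app f fun j => by refine Fin.cases h (fun _ => h') j

theorem eq_subst {σ τ : ℕ → Term} (h : ∀ i, Prf T Γ (eq (σ i) (τ i))) (t : Term) :
    Prf T Γ (eq (t.subst σ) (t.subst τ)) := by
  induction t with
  | var i => exact h i
  | app f t ih => exact eq_app f ih

end Prf

section

variable {T : Set Formula} {Γ Δ : List Formula} {σ τ : ℕ → Term} {φ ψ χ : Formula}

theorem Holds.congr (h : ∀ i, Prf T Γ (eq (σ i) (τ i))) :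
    Holds T Γ σ φ ↔ Holds T Γ τ φ := by
  have hcons : ∀ {Γ} {σ τ : ℕ → Term} (t : Term), (∀ i, Prf T Γ (eq (σ i) (τ i))) →
      ∀ i, Prf T Γ (eq ((t ∷ σ) i) ((t ∷ τ) i)) := by
    intro Γ σ τ t h i
    cases i with
    | zero => exact .eqI t
    | succ i => exact h i
  induction φ generalizing σ τ Γ with
  | bot => rfl
  | eq t u =>
    have ht := Prf.eq_subst h t
    have hu := Prf.eq_subst h u
    exact ⟨fun H => (ht.eq_symm.eq_trans H).eq_trans hu,
      fun H => (ht.eq_trans H).eq_trans hu.eq_symm⟩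
  | and φ ψ h₁ h₂ => exact holds_and.trans ((and_congr (h₁ h) (h₂ h)).trans holds_and.symm)
  | or φ ψ h₁ h₂ =>
    constructor <;> intro H
    · exact H.orE (fun Δ hΔ H => ((h₁ fun i => (h i).weaken hΔ).1 H).inl)
        fun Δ hΔ H => ((h₂ fun i => (h i).weaken hΔ).1 H).inr
    · exact H.orE (fun Δ hΔ H => ((h₁ fun i => (h i).weaken hΔ).2 H).inl)
        fun Δ hΔ H => ((h₂ fun i => (h i).weaken hΔ).2 H).inr
  | imp φ ψ h₁ h₂ =>
    rw [holds_imp, holds_imp]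
    exact forall_congr' fun Δ => forall_congr' fun hΔ =>
      imp_congr (h₁ fun i => (h i).weaken hΔ) (h₂ fun i => (h i).weaken hΔ)
  | all φ ih =>
    rw [holds_all, holds_all]
    exact forall_congr' fun t => ih (hcons t h)
  | ex φ ih =>
    constructor <;> intro H
    · exact H.exE fun Δ hΔ t H => .exI t ((ih (hcons t fun i => (h i).weaken hΔ)).1 H)
    · exact H.exE fun Δ hΔ t H => .exI t ((ih (hcons t fun i => (h i).weaken hΔ)).2 H)

namespace ExtendsHA

variable (hT : ExtendsHA T)
include hT

theorem ax (h : HAAxiom φ) : Prf T Γ φ := (hT φ h).weaken (List.nil_subset _)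

theorem succ_ne_zero {t : Term} (h : Prf T Γ (eq t.succ Term.zero)) : Prf T Γ φ :=
  .botE (.impE (hT.ax (.succ_ne_zero t)) h)

theorem succ_inj {t u : Term} (h : Prf T Γ (eq t.succ u.succ)) : Prf T Γ (eq t u) :=
  .impE (hT.ax (.succ_inj t u)) h

theorem induction (h₀ : Holds T Γ (Term.zero ∷ σ) φ)
    (hs : ∀ Δ, Γ ⊆ Δ → ∀ t, Holds T Δ (t ∷ σ) φ → Holds T Δ (t.succ ∷ σ) φ) (t : Term) :
    Holds T Γ (t ∷ σ) φ := by
  have h : Holds T Γ σ (imp (φ.inst Term.zero)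
      (imp (all (imp φ (φ.subst succSubst))) (all φ))) :=
    .of_provable (hT _ (.induction φ))
  refine holds_all.1 ((h.mp (holds_inst.2 (by rwa [subst_zero]))).mp
    (holds_all.2 fun t => holds_imp.2 fun Δ hΔ ht => holds_subst.2 ?_)) t
  convert hs Δ hΔ t ht using 1
  funext i
  cases i <;> rfl

theorem cases (h₀ : Holds T Γ (Term.zero ∷ σ) φ)
    (hs : ∀ Δ, Γ ⊆ Δ → ∀ t : Term, Holds T Δ (t.succ ∷ σ) φ) (t : Term) : Holds T Γ (t ∷ σ) φ :=
  hT.induction h₀ (fun Δ hΔ t _ => hs Δ hΔ t) t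

/-- Induction on `t` with `u` universally quantified, so that in the successor step `u` can be
replaced by its predecessor. -/
theorem eq_em (t u : Term) : Prf T Γ (or (eq t u) (eq t u).neg) := by
  have key : ∀ t : Term, Holds T Γ (t ∷ var)
      (all (or (eq (var 1) (var 0)) (eq (var 1) (var 0)).neg)) := by
    refine hT.induction (holds_all.2 (hT.cases (.inl (.eqI _)) ?_)) ?_
    · exact fun Δ _ u => .inr (holds_imp.2 fun E _ h => hT.succ_ne_zero (Prf.eq_symm h))
    · intro Δ hΔ t ih
      refine holds_all.2 (hT.cases ?_ ?_)
      · exact .inr (holds_imp.2 fun E _ h => hT.succ_ne_zero h)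
      · intro E hE u
        refine Holds.orE ((holds_all.1 ih u).mono hE) (fun F hF h => .inl (Prf.eq_succ h)) ?_
        exact fun F hF h => .inr (holds_imp.2 fun G hG h' => h.mp' hG (hT.succ_inj h'))
  exact holds_all.1 (key t) u

theorem qf_em (hφ : φ.QF) : Holds T Γ σ (or φ φ.neg) := by
  induction φ generalizing Γ with
  | bot => exact .inr (holds_imp.2 fun _ _ h => h)
  | eq t u => exact hT.eq_em _ _
  | and φ ψ h₁ h₂ =>
    refine (h₁ hφ.1 (Γ := Γ)).orE (fun Δ hΔ h => ?_) fun Δ _ h =>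
      .inr (holds_imp.2 fun E hE h' => h.mp' hE (holds_and.1 h').1)
    exact (h₂ hφ.2 (Γ := Δ)).orE (fun E hE h' => .inl (holds_and.2 ⟨h.mono hE, h'⟩))
      fun E _ h => .inr (holds_imp.2 fun F hF h' => h.mp' hF (holds_and.1 h').2)
  | or φ ψ h₁ h₂ =>
    refine (h₁ hφ.1 (Γ := Γ)).orE (fun Δ _ h => h.inl.inl) fun Δ hΔ h => ?_
    refine (h₂ hφ.2 (Γ := Δ)).orE (fun E _ h => h.inr.inl) fun E hE h' => .inr ?_
    exact holds_imp.2 fun F hF H => H.orE (fun G hG => h.mp' (List.Subset.trans hE (List.Subset.trans hF hG)))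
      fun G hG => h'.mp' (List.Subset.trans hF hG)
  | imp φ ψ h₁ h₂ =>
    refine (h₂ hφ.2 (Γ := Γ)).orE (fun Δ hΔ h => .inl (holds_imp.2 fun E hE _ => h.mono hE))
      fun Δ hΔ h => ?_
    refine (h₁ hφ.1 (Γ := Δ)).orE (fun E hE h' => ?_) fun E hE h' => ?_
    · exact .inr (holds_imp.2 fun F hF H => h.mp' (List.Subset.trans hE hF) (H.mp (h'.mono hF)))
    · exact .inl (holds_imp.2 fun F hF H => (h'.mp' hF H).botE)
  | all φ _ | ex φ _ => exact hφ.elim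

end ExtendsHA

end

-- A pairing function inside intuitionistic arithmetic

namespace PRFun

/-- Predecessor. -/
def pred : PRFun 1 := prec zero (proj 0)

/-- Addition, by recursion on the first argument. -/
def add : PRFun 2 := prec (proj 0) (comp succ fun _ => proj 1)

/-- `sub x y` is `y - x`. -/
def sub : PRFun 2 := prec (proj 0) (comp pred fun _ => proj 1)

/-- `jump v z` is `z + 1` if `v = 0`, and `v - 1` otherwise. -/
def jump : PRFun 2 := prec succ (proj 0)

/-- `countZero v c` is `c + 1` if `v = 0`, and `c` otherwise. -/
def countZero : PRFun 2 := prec succ (proj 2)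

/-- The sequence `0, 1, 0, 3, 2, 1, 0, 7, …` of countdowns. -/
def countdown : PRFun 1 := prec zero (comp jump (Fin.cons (proj 1) fun _ => proj 0))

/-- The number of zeros of `countdown` below the argument. -/
def runs : PRFun 1 :=
  prec zero (comp countZero (Fin.cons (comp countdown fun _ => proj 0) fun _ => proj 1))

/-- The second component of the number coding a pair, the first one being `countdown`. -/
def right : PRFun 1 := comp pred fun _ => comp sub (Fin.cons countdown fun _ => runs)

end PRFun

namespace ExtendsHA

open PRFun

variable {T : Set Formula} {Γ : List Formula} {φ : Formula} (hT : ExtendsHA T)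
include hT

theorem prec_zero_one (f : PRFun 0) (g : PRFun 2) :
    Prf T Γ (eq (app1 (prec f g) Term.zero) (app f Fin.elim0)) := by
  have h := hT.ax (Γ := Γ) (.prec_zero f g Fin.elim0)
  rwa [show (Fin.cons Term.zero Fin.elim0 : Fin 1 → Term) = fun _ => Term.zero from
    funext fun j => by rw [Fin.fin_one_eq_zero j]; rfl] at h

theorem prec_succ_one (f : PRFun 0) (g : PRFun 2) (t : Term) :
    Prf T Γ (eq (app1 (prec f g) t.succ) (app2 g t (app1 (prec f g) t))) := by
  have hc : ∀ t : Term, (Fin.cons t Fin.elim0 : Fin 1 → Term) = fun _ => t := fun t =>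
    funext fun j => by rw [Fin.fin_one_eq_zero j]; rfl
  have h := hT.ax (Γ := Γ) (.prec_succ f g t Fin.elim0)
  rwa [hc, hc, hc] at h

theorem prec_zero_two (f : PRFun 1) (g : PRFun 3) (u : Term) :
    Prf T Γ (eq (app2 (prec f g) Term.zero u) (app1 f u)) :=
  hT.ax (.prec_zero f g fun _ => u)

theorem prec_succ_two (f : PRFun 1) (g : PRFun 3) (t u : Term) :
    Prf T Γ (eq (app2 (prec f g) t.succ u)
      (app g (Fin.cons t (Fin.cons (app2 (prec f g) t u) fun _ => u)))) :=
  hT.ax (.prec_succ f g t fun _ => u)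

theorem comp_one {n : ℕ} (f : PRFun 1) (g : PRFun n) (t : Fin n → Term) :
    Prf T Γ (eq (app (comp f fun _ => g) t) (app1 f (app g t))) :=
  hT.ax (.comp f (fun _ => g) t)

theorem comp_two {n : ℕ} (f : PRFun 2) (g h : PRFun n) (t : Fin n → Term) :
    Prf T Γ (eq (app (comp f (Fin.cons g fun _ => h)) t) (app2 f (app g t) (app h t))) := by
  have h' := hT.ax (Γ := Γ) (.comp f (Fin.cons g fun _ => h) t)
  rwa [show (fun j => app ((Fin.cons g fun _ => h : Fin 2 → PRFun n) j) t) =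
    (Fin.cons (app g t) fun _ => app h t) from
      funext fun j => by refine Fin.cases ?_ (fun _ => ?_) j <;> rfl] at h'

theorem proj_eq {n : ℕ} (i : Fin n) (t : Fin n → Term) :
    Prf T Γ (eq (app (proj i) t) (t i)) := hT.ax (.proj i t)

theorem pred_succ (t : Term) : Prf T Γ (eq (app1 pred t.succ) t) :=
  (hT.prec_succ_one _ _ t).eq_trans (hT.proj_eq _ _)

theorem zero_add (t : Term) : Prf T Γ (eq (app2 add Term.zero t) t) :=
  (hT.prec_zero_two _ _ t).eq_trans (hT.proj_eq _ _)

theorem succ_add (t u : Term) : Prf T Γ (eq (app2 add t.succ u) (app2 add t u).succ) :=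
  ((hT.prec_succ_two _ _ t u).eq_trans (hT.comp_one _ _ _)).eq_trans
    (Prf.eq_succ (hT.proj_eq _ _))

theorem zero_sub (t : Term) : Prf T Γ (eq (app2 sub Term.zero t) t) :=
  (hT.prec_zero_two _ _ t).eq_trans (hT.proj_eq _ _)

theorem succ_sub (t u : Term) :
    Prf T Γ (eq (app2 sub t.succ u) (app1 pred (app2 sub t u))) :=
  ((hT.prec_succ_two _ _ t u).eq_trans (hT.comp_one _ _ _)).eq_trans
    (Prf.eq_app1 _ (hT.proj_eq _ _))

theorem jump_zero (t : Term) : Prf T Γ (eq (app2 jump Term.zero t) t.succ) :=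
  hT.prec_zero_two _ _ t

theorem jump_succ (t u : Term) : Prf T Γ (eq (app2 jump t.succ u) t) :=
  (hT.prec_succ_two _ _ t u).eq_trans (hT.proj_eq _ _)

theorem countZero_zero (t : Term) : Prf T Γ (eq (app2 countZero Term.zero t) t.succ) :=
  hT.prec_zero_two _ _ t

theorem countZero_succ (t u : Term) : Prf T Γ (eq (app2 countZero t.succ u) u) :=
  (hT.prec_succ_two _ _ t u).eq_trans (hT.proj_eq _ _)

theorem countdown_zero : Prf T Γ (eq (app1 countdown Term.zero) Term.zero) := by
  have h := hT.prec_zero_one (Γ := Γ) PRFun.zero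
    (comp jump (Fin.cons (proj 1) fun _ => proj 0))
  exact h

theorem countdown_succ (t : Term) :
    Prf T Γ (eq (app1 countdown t.succ) (app2 jump (app1 countdown t) t)) :=
  ((hT.prec_succ_one _ _ t).eq_trans (hT.comp_two _ _ _ _)).eq_trans
    (Prf.eq_app2 _ (hT.proj_eq _ _) (hT.proj_eq _ _))

theorem runs_zero : Prf T Γ (eq (app1 runs Term.zero) Term.zero) :=
  hT.prec_zero_one PRFun.zero _

theorem runs_succ (t : Term) :
    Prf T Γ (eq (app1 runs t.succ) (app2 countZero (app1 countdown t) (app1 runs t))) :=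
  ((hT.prec_succ_one _ _ t).eq_trans (hT.comp_two _ _ _ _)).eq_trans
    (Prf.eq_app2 _ ((hT.comp_one _ _ _).eq_trans (Prf.eq_app1 _ (hT.proj_eq _ _)))
      (hT.proj_eq _ _))

theorem right_eq (t : Term) :
    Prf T Γ (eq (app1 right t) (app1 pred (app2 sub (app1 countdown t) (app1 runs t)))) :=
  (hT.comp_one _ _ _).eq_trans (Prf.eq_app1 _ (hT.comp_two _ _ _ _))

theorem add_zero (t : Term) : Prf T Γ (eq (app2 add t Term.zero) t) := by
  have := hT.induction (Γ := Γ) (σ := var) (φ := eq (app2 add (var 0) Term.zero) (var 0))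
    (by simpa [holds_eq] using hT.zero_add Term.zero)
    (fun Δ _ t h => by
      simp only [holds_eq, subst_app2, subst_zero, subst_var, scons_zero] at h ⊢
      exact (hT.succ_add _ _).eq_trans (Prf.eq_succ h)) t
  simpa [holds_eq] using this

theorem add_succ (t u : Term) : Prf T Γ (eq (app2 add t u.succ) (app2 add t u).succ) := by
  have := hT.induction (Γ := Γ) (σ := u ∷ var)
    (φ := eq (app2 add (var 0) (var 1).succ) (app2 add (var 0) (var 1)).succ)
    (by
      simp only [holds_eq, subst_app2, subst_succ, subst_var, scons_zero, scons_one]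
      exact (hT.zero_add _).eq_trans (Prf.eq_succ (hT.zero_add _).eq_symm))
    (fun Δ _ t h => by
      simp only [holds_eq, subst_app2, subst_succ, subst_var, scons_zero, scons_one] at h ⊢
      exact ((hT.succ_add _ _).eq_trans (Prf.eq_succ h)).eq_trans
        (Prf.eq_succ (hT.succ_add _ _).eq_symm)) t
  simpa [holds_eq] using this

theorem add_assoc (t u v : Term) :
    Prf T Γ (eq (app2 add (app2 add t u) v) (app2 add t (app2 add u v))) := by
  have := hT.induction (Γ := Γ) (σ := u ∷ v ∷ var)
    (φ := eq (app2 add (app2 add (var 0) (var 1)) (var 2))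
      (app2 add (var 0) (app2 add (var 1) (var 2))))
    (by
      simp only [holds_eq, subst_app2, subst_var, scons_zero, scons_one, scons_two]
      exact (Prf.eq_app2 _ (hT.zero_add _) (.eqI _)).eq_trans (hT.zero_add _).eq_symm)
    (fun Δ _ t h => by
      simp only [holds_eq, subst_app2, subst_var, scons_zero, scons_one, scons_two] at h ⊢
      exact (((Prf.eq_app2 _ (hT.succ_add _ _) (.eqI _)).eq_trans (hT.succ_add _ _)).eq_trans
        (Prf.eq_succ h)).eq_trans (hT.succ_add _ _).eq_symm) t
  simpa [holds_eq] using this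

theorem sub_add (t u : Term) : Prf T Γ (eq (app2 sub t (app2 add u t)) u) := by
  have := hT.induction (Γ := Γ) (σ := var)
    (φ := all (eq (app2 sub (var 1) (app2 add (var 0) (var 1))) (var 0)))
    (holds_all.2 fun u => by
      simp only [holds_eq, subst_app2, subst_var, scons_zero, scons_one]
      exact (hT.zero_sub _).eq_trans (hT.add_zero _))
    (fun Δ _ t h => holds_all.2 fun u => by
      have h := holds_all.1 h u.succ
      simp only [holds_eq, subst_app2, subst_var, scons_zero, scons_one] at h ⊢
      refine ((hT.succ_sub _ _).eq_trans (Prf.eq_app1 _ ((Prf.eq_app2 _ (.eqI _) ?_).eq_trans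
        h))).eq_trans (hT.pred_succ _)
      exact (hT.add_succ _ _).eq_trans (hT.succ_add _ _).eq_symm) t
  simpa [holds_eq] using holds_all.1 this u

/-- Within the run that begins at `z + 1`, the countdown is explicit. -/
theorem countdown_run {z j : Term} (hz : Prf T Γ (eq (app1 countdown z) Term.zero))
    (hj : Prf T Γ (eq (app1 runs z) j)) (i x : Term)
    (hx : Prf T Γ (eq (app2 add i x) z.succ)) :
    Prf T Γ (eq (app1 countdown (app2 add i z.succ)) x) ∧
      Prf T Γ (eq (app1 runs (app2 add i z.succ)) j.succ) := by
  have := hT.induction (Γ := Γ) (σ := z ∷ j ∷ var)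
    (φ := all (imp (eq (app2 add (var 1) (var 0)) (var 2).succ)
      (and (eq (app1 countdown (app2 add (var 1) (var 2).succ)) (var 0))
        (eq (app1 runs (app2 add (var 1) (var 2).succ)) (var 3).succ))))
    (holds_all.2 fun x => holds_imp.2 fun Δ hΔ h => by
      simp only [holds_and, holds_eq, subst_app2, subst_app1, subst_succ, subst_var, scons_zero,
        scons_one, scons_two, scons_three] at h ⊢
      have hx := (hT.zero_add x).eq_symm.eq_trans h
      constructor
      · refine ((Prf.eq_app1 _ (hT.zero_add _)).eq_trans (hT.countdown_succ _)).eq_trans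
          (((Prf.eq_app2 _ (hz.weaken hΔ) (.eqI _)).eq_trans (hT.jump_zero _)).eq_trans
            hx.eq_symm)
      · exact ((Prf.eq_app1 _ (hT.zero_add _)).eq_trans (hT.runs_succ _)).eq_trans
          ((Prf.eq_app2 _ (hz.weaken hΔ) (hj.weaken hΔ)).eq_trans (hT.countZero_zero _)))
    (fun Δ _ t h => holds_all.2 fun x => holds_imp.2 fun E hE hx => by
      have h := holds_imp.1 (holds_all.1 h x.succ) E hE
      simp only [holds_and, holds_eq, subst_app2, subst_app1, subst_succ, subst_var, scons_zero,
        scons_one, scons_two, scons_three] at h hx ⊢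
      obtain ⟨h₁, h₂⟩ := h (((hT.add_succ _ _).eq_trans (hT.succ_add _ _).eq_symm).eq_trans hx)
      constructor
      · exact ((Prf.eq_app1 _ (hT.succ_add _ _)).eq_trans (hT.countdown_succ _)).eq_trans
          ((Prf.eq_app2 _ h₁ (.eqI _)).eq_trans (hT.jump_succ _ _))
      · exact ((Prf.eq_app1 _ (hT.succ_add _ _)).eq_trans (hT.runs_succ _)).eq_trans
          ((Prf.eq_app2 _ h₁ h₂).eq_trans (hT.countZero_succ _ _))) i
  have := holds_imp.1 (holds_all.1 this x) Γ (List.Subset.refl _)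
  simp only [holds_and, holds_eq, subst_app2, subst_app1, subst_succ, subst_var, scons_zero,
    scons_one, scons_two, scons_three] at this
  exact this hx

/-- For every `j` there is a zero `z` of `countdown` with exactly `j` zeros before it. The equation
`z = w + j` records `z ≥ j`, so the run after `z`, which starts from the value `z + 1`, is long
enough to meet every number up to `j`. -/
theorem exists_run (j : Term)
    (h : ∀ Δ, Γ ⊆ Δ → ∀ z w, Prf T Δ (eq z (app2 add w j)) →
      Prf T Δ (eq (app1 countdown z) Term.zero) → Prf T Δ (eq (app1 runs z) j) → Prf T Δ φ) :
    Prf T Γ φ := by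
  have := hT.induction (Γ := Γ) (σ := var)
    (φ := ex (ex (and (eq (var 1) (app2 add (var 0) (var 2)))
      (and (eq (app1 countdown (var 1)) Term.zero) (eq (app1 runs (var 1)) (var 2))))))
    (by
      refine Holds.exI Term.zero (Holds.exI Term.zero ?_)
      simp only [holds_and, holds_eq, subst_app2, subst_app1, subst_zero, subst_var, scons_zero,
        scons_one, scons_two]
      exact ⟨(hT.zero_add _).eq_symm, hT.countdown_zero, hT.runs_zero⟩)
    (fun Δ _ t h => by
      refine h.exE fun E hE z h => h.exE fun F hF w h => ?_
      simp only [holds_and, holds_eq, subst_app2, subst_app1, subst_zero, subst_var, scons_zero,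
        scons_one, scons_two] at h
      obtain ⟨h₁, h₂, h₃⟩ := h
      obtain ⟨h₄, h₅⟩ := hT.countdown_run h₂ h₃ z.succ Term.zero (hT.add_zero _)
      -- The run starting at position `z + 1` has value `z + 1` there, so it reaches zero after `z +
      -- 1` further steps.
      refine Holds.exI (app2 add z.succ z.succ) (Holds.exI (app2 add z.succ w) ?_)
      simp only [holds_and, holds_eq, subst_app2, subst_app1, subst_zero, subst_var, scons_zero,
        scons_one, scons_two]
      refine ⟨?_, h₄, h₅⟩
      refine (Prf.eq_app2 _ (.eqI _) ?_).eq_trans (hT.add_assoc _ _ _).eq_symm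
      exact (Prf.eq_succ h₁).eq_trans (hT.add_succ _ _).eq_symm) j
  rw [← holds_var (φ := φ)]
  refine this.exE fun E hE z h' => h'.exE fun F hF w h' => ?_
  simp only [holds_and, holds_eq, subst_app2, subst_app1, subst_zero, subst_var, scons_zero,
    scons_one, scons_two] at h'
  exact holds_var.2 (h F (List.Subset.trans hE hF) z w h'.1 h'.2.1 h'.2.2)

/-- Every pair of numbers has a code. -/
theorem exists_pair (x y : Term)
    (h : ∀ Δ, Γ ⊆ Δ → ∀ z, Prf T Δ (eq (app1 countdown z) x) →
      Prf T Δ (eq (app1 right z) y) → Prf T Δ φ) : Prf T Γ φ := by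
  -- The code of `(x, y)` is placed in the run after the zero number `y + x`. With `z = w + (y +
  -- x)`, the value `x` occurs `w + y + 1` steps into the run; `runs` is `y + x + 1` there, and
  -- subtracting `x` and then `1` leaves `y`.
  refine hT.exists_run (app2 add y x) fun Δ hΔ z w hz h₀ h₁ => ?_
  obtain ⟨h₂, h₃⟩ := hT.countdown_run h₀ h₁ (app2 add w y).succ x ((hT.succ_add _ _).eq_trans
    (Prf.eq_succ ((hT.add_assoc _ _ _).eq_trans hz.eq_symm)))
  refine h Δ hΔ _ h₂ ?_
  refine ((hT.right_eq _).eq_trans (Prf.eq_app1 _ ((Prf.eq_app2 _ h₂ (h₃.eq_trans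
    (hT.succ_add _ _).eq_symm)).eq_trans (hT.sub_add _ _)))).eq_trans (hT.pred_succ _)

end ExtendsHA

-- Sequences as numbers; reduction to a single parameter

/-- The components of the number coding a sequence. -/
def component : ℕ → Term → Term
  | 0, t => app1 PRFun.countdown t
  | i + 1, t => component i (app1 PRFun.right t)

theorem subst_component (i : ℕ) (t : Term) (σ : ℕ → Term) :
    (component i t).subst σ = component i (t.subst σ) := by
  induction i generalizing t with
  | zero => rfl
  | succ i ih => exact ih _

theorem fv_component (i j : ℕ) : (component i (var j)).fv = {j} := by
  have h : ∀ (t : Term), (component i t).fv = t.fv := by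
    induction i with
    | zero => exact fun t => Set.iUnion_const _
    | succ i ih => exact fun t => (ih _).trans (Set.iUnion_const _)
  exact h _

section

variable {T : Set Formula} {Γ Δ : List Formula} {σ τ : ℕ → Term} {φ ψ χ : Formula}

theorem Prf.eq_component {t u : Term} (h : Prf T Γ (eq t u)) (i : ℕ) :
    Prf T Γ (eq (component i t) (component i u)) := by
  induction i generalizing t u with
  | zero => exact Prf.eq_app1 _ h
  | succ i ih => exact ih (Prf.eq_app1 _ h)

theorem ExtendsHA.exists_code (hT : ExtendsHA T) (n : ℕ) (σ : ℕ → Term)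
    (h : ∀ Δ, Γ ⊆ Δ → ∀ z, (∀ i < n, Prf T Δ (eq (component i z) (σ i))) → Prf T Δ φ) :
    Prf T Γ φ := by
  induction n generalizing Γ σ with
  | zero => exact h Γ (List.Subset.refl _) Term.zero fun i hi => absurd hi (Nat.not_lt_zero i)
  | succ n ih =>
    refine ih (fun i => σ (i + 1)) fun Δ hΔ y hy => ?_
    refine hT.exists_pair (σ 0) y fun E hE z hz hz' => h E (List.Subset.trans hΔ hE) z ?_
    intro i hi
    cases i with
    | zero => exact hz
    | succ i =>
      exact (hz'.eq_component i).eq_trans ((hy i (Nat.lt_of_succ_lt_succ hi)).weaken hE)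

/-- A formula is provable if it is provable for parameters that are the components of a
single number. -/
theorem ExtendsHA.provable_of_component (hT : ExtendsHA T)
    (h : Provable T (φ.subst fun i => component i (var 0))) : Provable T φ := by
  rw [provable_iff_holds] at h ⊢
  intro Γ σ
  obtain ⟨N, hN⟩ := φ.fv_bounded
  refine hT.exists_code N σ fun Δ hΔ z hz => ?_
  have h' := holds_subst.1 (h Δ (z ∷ σ))
  simp only [subst_component, subst_var, scons_zero] at h'
  -- A code only controls finitely many components. Beyond `N` no variable occurs in `φ`, so the
  -- environment may be altered there to agree with the components of `z`.
  have hσ : φ.subst σ = φ.subst fun i => if i < N then σ i else component i z :=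
    subst_congr fun i hi => (if_pos (hN i hi)).symm
  rw [hσ]
  refine (Holds.congr fun i => ?_).1 h'
  by_cases hi : i < N
  · simpa [hi] using hz i hi
  · simpa [hi] using Prf.eqI _

end

end Arith

namespace Arith

open Formula

-- The negative translation relative to a formula `A`

/-- Double negation relative to `A` in place of falsity. -/
abbrev dneg (A φ : Formula) : Formula := imp (imp φ A) A

/-- The negative translation with `A` in place of falsity. -/
def tr : Formula → Formula → Formula
  | A, Formula.bot => A
  | A, Formula.eq t u => Formula.or (eq t u) A
  | A, Formula.and φ ψ => Formula.and (tr A φ) (tr A ψ)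
  | A, Formula.or φ ψ => dneg A (Formula.or (tr A φ) (tr A ψ))
  | A, Formula.imp φ ψ => imp (tr A φ) (tr A ψ)
  | A, Formula.all φ => all (tr A.shift φ)
  | A, Formula.ex φ => dneg A (ex (tr A.shift φ))

theorem tr_subst (A φ : Formula) (σ : ℕ → Term) :
    (tr A φ).subst σ = tr (A.subst σ) (φ.subst σ) := by
  induction φ generalizing A σ with
  | bot | eq t u => rfl
  | and φ ψ h₁ h₂ | or φ ψ h₁ h₂ | imp φ ψ h₁ h₂ => simp only [tr, Formula.subst, h₁, h₂]
  | all φ h | ex φ h => simp only [tr, Formula.subst, h, shift_subst_up]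

theorem tr_shift (A φ : Formula) : tr A.shift φ.shift = (tr A φ).shift :=
  (tr_subst A φ _).symm

theorem tr_inst (A φ : Formula) (t : Term) : tr A (φ.inst t) = (tr A.shift φ).inst t := by
  conv_lhs => rw [← shift_inst A t]
  exact (tr_subst _ _ _).symm

theorem map_tr_shift (A : Formula) (Γ : List Formula) :
    (Γ.map shift).map (tr A.shift) = (Γ.map (tr A)).map shift := by
  simp only [List.map_map]
  exact List.map_congr_left fun φ _ => tr_shift A φ

section

variable {T : Set Formula} {Γ Δ : List Formula} {σ τ : ℕ → Term} {A φ ψ χ : Formula}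

theorem Holds.dneg_mono (h : Holds T Γ σ (dneg A φ))
    (hφ : ∀ Δ, Γ ⊆ Δ → Holds T Δ σ φ → Holds T Δ σ ψ) : Holds T Γ σ (dneg A ψ) :=
  holds_imp.2 fun _ hΔ hn => h.mp' hΔ (holds_imp.2 fun E hE hE' =>
    hn.mp' hE (hφ E (List.Subset.trans hΔ hE) hE'))

theorem Holds.dneg (h : Holds T Γ σ φ) : Holds T Γ σ (dneg A φ) :=
  holds_imp.2 fun _ hΔ hn => hn.mp (h.mono hΔ)

theorem Holds.dneg_dneg (h : Holds T Γ σ (Arith.dneg A (Arith.dneg A φ))) :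
    Holds T Γ σ (Arith.dneg A φ) :=
  holds_imp.2 fun _ hΔ hn => h.mp' hΔ (holds_imp.2 fun _ hE h' => h'.mp (hn.mono hE))

/-- Disjunction and existence carry a relative double negation already, and the other connectives
inherit stability. For equations, decidability of equality allows the plain `t = u ∨ A`. -/
theorem Holds.tr_stable (hT : ExtendsHA T) (h : Holds T Γ σ (Arith.dneg A (tr A φ))) :
    Holds T Γ σ (tr A φ) := by
  induction φ generalizing A Γ σ with
  | bot => exact h.mp (holds_imp.2 fun _ _ h => h)
  | eq t u =>
    refine Holds.orE (σ := σ) (φ := eq t u) (ψ := (eq t u).neg)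
      (hT.eq_em (t.subst σ) (u.subst σ)) (fun Δ _ h' => h'.inl) fun Δ hΔ h' => ?_
    refine .inr (h.mp' hΔ (holds_imp.2 fun E hE H =>
      H.orE (fun F hF hF' => ?_) fun _ _ h => h))
    exact (h'.mp' (List.Subset.trans hE hF) hF').botE
  | and φ ψ h₁ h₂ =>
    exact holds_and.2 ⟨h₁ (h.dneg_mono fun _ _ h => (holds_and.1 h).1),
      h₂ (h.dneg_mono fun _ _ h => (holds_and.1 h).2)⟩
  | or φ ψ _ _ => exact h.dneg_dneg
  | imp φ ψ _ ih =>
    exact holds_imp.2 fun Δ hΔ hφ => ih ((h.mono hΔ).dneg_mono fun E hE h =>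
      Holds.mp h (hφ.mono hE))
  | all φ ih =>
    exact holds_all.2 fun t => ih (holds_imp.2 fun Δ hΔ hn => holds_shift.2
      (h.mp' hΔ (holds_imp.2 fun E hE h' =>
        holds_shift.1 (hn.mp' hE (holds_all.1 h' t)))))
  | ex φ _ => exact h.dneg_dneg

/-- When the goal is a translation, which is stable, a formula known only up to relative double
negation may be used as if it were known. This handles the elimination rules for `∨` and `∃` in
`tr_sound`. -/
theorem Prf.tr_elim (hT : ExtendsHA T) (h : Prf T Γ (dneg A χ))
    (hχ : ∀ Δ, Γ ⊆ Δ → Prf T Δ χ → Prf T Δ (tr A ψ)) : Prf T Γ (tr A ψ) := by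
  refine holds_var.1 (Holds.tr_stable hT ((holds_var.2 h).dneg_mono fun Δ hΔ h => ?_))
  exact holds_var.2 (hχ Δ hΔ (holds_var.1 h))

theorem Prf.dneg (h : Prf T Γ φ) : Prf T Γ (dneg A φ) := holds_var.1 (holds_var.2 h).dneg

theorem Prf.tr_bot_elim (hT : ExtendsHA T) (h : Prf T Γ A) : Prf T Γ (tr A φ) :=
  Prf.tr_elim hT (χ := bot) (Prf.imp_iff.2 fun _ hΔ _ => h.weaken hΔ) fun _ _ h => .botE h

theorem tr_haAxiom (hT : ExtendsHA T) (h : HAAxiom φ) : Prf T Γ (tr A φ) := by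
  cases h with
  | succ_ne_zero t =>
    exact Prf.imp_iff.2 fun Δ _ h => Prf.or_elim h (fun E _ h => hT.succ_ne_zero h)
      fun _ _ h => h
  | succ_inj t u =>
    exact Prf.imp_iff.2 fun Δ _ h => Prf.or_elim h (fun E _ h => .orI₁ (hT.succ_inj h))
      fun _ _ h => .orI₂ h
  | proj i t => exact .orI₁ (hT.ax (.proj i t))
  | comp f g t => exact .orI₁ (hT.ax (.comp f g t))
  | prec_zero f g t => exact .orI₁ (hT.ax (.prec_zero f g t))
  | prec_succ f g s t => exact .orI₁ (hT.ax (.prec_succ f g s t))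
  | induction φ =>
    have h := hT.ax (Γ := Γ) (.induction (tr A.shift φ))
    -- The translation of an induction axiom is the induction axiom of the translated formula, as
    -- `A.shift` does not mention the induction variable.
    rw [← tr_inst, tr_subst] at h
    rw [show A.shift.subst succSubst = A.shift by
      rw [shift, Formula.subst_subst]; rfl] at h
    exact h

/-- The translation takes classical derivations to intuitionistic ones. -/
theorem tr_sound (hT : ExtendsHA T) (h : Prf PA Γ φ) (A : Formula) :
    Prf T (Γ.map (tr A)) (tr A φ) := by
  induction h generalizing A with
  | ax h =>
    rcases h with h | ⟨φ, rfl⟩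
    · exact tr_haAxiom hT h
    -- Excluded middle becomes the relative double negation of `B ∨ (B → A)`, with `B` the
    -- translation of `φ`, which is intuitionistically valid.
    · exact Prf.imp_iff.2 fun Δ _ h => .impE h (.orI₂ (Prf.imp_iff.2 fun E hE h' =>
        .impE (h.weaken hE) (.orI₁ h')))
  | hyp h => exact .hyp (List.mem_map_of_mem h)
  | botE _ ih => exact Prf.tr_bot_elim hT (ih A)
  | andI _ _ ih₁ ih₂ => exact .andI (ih₁ A) (ih₂ A)
  | andE₁ _ ih => exact .andE₁ (ih A)
  | andE₂ _ ih => exact .andE₂ (ih A)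
  | orI₁ _ ih => exact Prf.dneg (.orI₁ (ih A))
  | orI₂ _ ih => exact Prf.dneg (.orI₂ (ih A))
  | orE _ _ _ ih ih₁ ih₂ =>
    exact Prf.tr_elim hT (ih A) fun Δ hΔ h => .orE h
      ((ih₁ A).weaken (List.cons_subset_cons _ hΔ)) ((ih₂ A).weaken (List.cons_subset_cons _ hΔ))
  | impI _ ih => exact .impI (ih A)
  | impE _ _ ih₁ ih₂ => exact .impE (ih₁ A) (ih₂ A)
  | allI _ ih =>
    refine .allI ?_
    rw [← map_tr_shift]
    exact ih A.shift
  | allE t _ ih =>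
    rw [tr_inst]
    exact .allE t (ih A)
  | exI t _ ih =>
    have := ih A
    rw [tr_inst] at this
    exact Prf.dneg (.exI t this)
  | exE _ _ ih₁ ih₂ =>
    refine Prf.tr_elim hT (ih₁ A) fun Δ hΔ h => .exE h ?_
    have := ih₂ A.shift
    rw [List.map_cons, map_tr_shift, tr_shift] at this
    exact this.weaken (List.cons_subset_cons _ (List.map_subset _ hΔ))
  | eqI t => exact .orI₁ (.eqI t)
  | eqE φ _ _ ih₁ ih₂ =>
    refine Prf.or_elim (ih₁ A) (fun Δ hΔ h => ?_) fun Δ _ h => Prf.tr_bot_elim hT h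
    have := (ih₂ A).weaken hΔ
    rw [tr_inst] at this ⊢
    exact .eqE _ h this

theorem tr_provable (hT : ExtendsHA T) (h : Provable PA φ) (A : Formula) :
    Provable T (tr A φ) := tr_sound hT h A

end

-- Provable equivalence

section Eqv

/-- Provable equivalence. -/
def Eqv (T : Set Formula) (φ ψ : Formula) : Prop := ∀ Γ σ, Holds T Γ σ φ ↔ Holds T Γ σ ψ

variable {T : Set Formula} {Γ Δ : List Formula} {σ τ : ℕ → Term} {φ ψ χ φ' ψ' : Formula}

theorem eqv_iff : Eqv T φ ψ ↔ Provable T (Formula.iff φ ψ) := provable_iff_iff.symm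

theorem Eqv.refl : Eqv T φ φ := fun _ _ => Iff.rfl

theorem Eqv.symm (h : Eqv T φ ψ) : Eqv T ψ φ := fun Γ σ => (h Γ σ).symm

theorem Eqv.trans (h : Eqv T φ ψ) (h' : Eqv T ψ χ) : Eqv T φ χ :=
  fun Γ σ => (h Γ σ).trans (h' Γ σ)

theorem Eqv.and (h : Eqv T φ φ') (h' : Eqv T ψ ψ') : Eqv T (and φ ψ) (and φ' ψ') :=
  fun Γ σ => holds_and.trans ((and_congr (h Γ σ) (h' Γ σ)).trans holds_and.symm)

theorem Holds.or_mono (H : Holds T Γ σ (or φ ψ))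
    (h : ∀ Δ, Γ ⊆ Δ → Holds T Δ σ φ → Holds T Δ τ φ')
    (h' : ∀ Δ, Γ ⊆ Δ → Holds T Δ σ ψ → Holds T Δ τ ψ') : Holds T Γ τ (or φ' ψ') :=
  H.orE (fun Δ hΔ H => (h Δ hΔ H).inl) fun Δ hΔ H => (h' Δ hΔ H).inr

theorem Eqv.or (h : Eqv T φ φ') (h' : Eqv T ψ ψ') : Eqv T (or φ ψ) (or φ' ψ') :=
  fun _ σ => ⟨fun H => H.or_mono (fun Δ _ => (h Δ σ).1) fun Δ _ => (h' Δ σ).1,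
    fun H => H.or_mono (fun Δ _ => (h Δ σ).2) fun Δ _ => (h' Δ σ).2⟩

theorem Eqv.imp (h : Eqv T φ φ') (h' : Eqv T ψ ψ') : Eqv T (imp φ ψ) (imp φ' ψ') :=
  fun _ σ => holds_imp.trans ((forall_congr' fun Δ => forall_congr' fun _ =>
    imp_congr (h Δ σ) (h' Δ σ)).trans holds_imp.symm)

theorem Eqv.neg (h : Eqv T φ φ') : Eqv T φ.neg φ'.neg := h.imp .refl

theorem Eqv.all (h : Eqv T φ φ') : Eqv T (all φ) (all φ') :=
  fun Γ _ => holds_all.trans ((forall_congr' fun _ => h Γ _).trans holds_all.symm)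

theorem Holds.ex_mono (H : Holds T Γ σ (ex φ))
    (h : ∀ Δ, Γ ⊆ Δ → ∀ t, Holds T Δ (t ∷ σ) φ → Holds T Δ (t ∷ τ) φ') :
    Holds T Γ τ (ex φ') :=
  H.exE fun Δ hΔ t H => .exI t (h Δ hΔ t H)

theorem Eqv.ex (h : Eqv T φ φ') : Eqv T (ex φ) (ex φ') :=
  fun _ _ => ⟨fun H => H.ex_mono fun Δ _ _ => (h Δ _).1, fun H => H.ex_mono fun Δ _ _ => (h Δ _).2⟩

theorem eqv_all_shift : Eqv T φ φ.shift.all :=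
  fun _ _ => ⟨fun h => holds_all.2 fun _ => holds_shift.2 h,
    fun h => holds_shift.1 (holds_all.1 h Term.zero)⟩

theorem eqv_ex_shift : Eqv T φ φ.shift.ex :=
  fun _ _ => ⟨fun h => .exI Term.zero (holds_shift.2 h),
    fun h => h.exE fun _ _ _ h => holds_shift.1 h⟩

theorem eqv_not_ex : Eqv T (neg (ex φ)) (all (neg φ)) := fun _ _ =>
  ⟨fun h => holds_all.2 fun t => holds_imp.2 fun _ hΔ H => h.mp' hΔ (.exI t H),
    fun h => holds_imp.2 fun _ hΔ H => H.exE fun _ hE t H =>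
      Holds.botE ((holds_all.1 h t).mp' (List.Subset.trans hΔ hE) H)⟩

/-- Reasoning by cases on a decidable formula. -/
theorem Holds.by_cases (hφ : Provable T (Formula.or φ φ.neg))
    (h₁ : ∀ Δ, Γ ⊆ Δ → Holds T Δ σ φ → Holds T Δ τ ψ)
    (h₂ : ∀ Δ, Γ ⊆ Δ → Holds T Δ σ φ.neg → Holds T Δ τ ψ) : Holds T Γ τ ψ :=
  (Holds.of_provable hφ).orE h₁ h₂

theorem Holds.of_neg_neg (hφ : Provable T (Formula.imp φ.neg.neg φ))
    (h : ∀ Δ, Γ ⊆ Δ → Holds T Δ σ φ.neg → Holds T Δ σ bot) : Holds T Γ σ φ :=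
  (Holds.of_provable hφ).mp (holds_imp.2 h)

theorem provable_stable_of_em (hφ : Provable T (Formula.or φ φ.neg)) :
    Provable T (Formula.imp φ.neg.neg φ) :=
  provable_imp_iff.2 fun _ _ h => Holds.by_cases hφ (fun _ _ h => h)
    fun _ hΔ h' => (h.mp' hΔ h').botE

theorem em_PA (φ : Formula) : Provable PA (Formula.or φ φ.neg) := .ax (Or.inr ⟨φ, rfl⟩)

end Eqv

-- Prenex classes, uniformly in the outermost quantifier

/-- The quantifier that belongs to a symbol. -/
def quant : Sgn → Formula → Formula
  | Sgn.plus => ex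
  | Sgn.minus => all

@[simp] theorem Sgn.flip_flip (b : Sgn) : b.flip.flip = b := by cases b <;> rfl

theorem Sgn.eq_or_eq_flip (a b : Sgn) : a = b ∨ a = b.flip := by
  cases a <;> cases b <;> simp [flip]

theorem Sgn.flip_ne (b : Sgn) : b.flip ≠ b := by cases b <;> simp [flip]

theorem fv_quant (b : Sgn) (φ : Formula) : (quant b φ).fv = {i | i + 1 ∈ φ.fv} := by
  cases b <;> rfl

theorem subst_quant (b : Sgn) (φ : Formula) (σ : ℕ → Term) :
    (quant b φ).subst σ = quant b (φ.subst (up σ)) := by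
  cases b <;> rfl

theorem fv_quant_shift (b : Sgn) (φ : Formula) : (quant b φ.shift).fv = φ.fv := by
  cases b
  · exact fv_ex_shift φ
  · exact fv_all_shift φ

theorem Eqv.quant {T : Set Formula} {φ ψ : Formula} (h : Eqv T φ ψ) (b : Sgn) :
    Eqv T (quant b φ) (quant b ψ) := by
  cases b
  · exact h.ex
  · exact h.all

theorem eqv_quant_shift {T : Set Formula} {φ : Formula} (b : Sgn) :
    Eqv T φ (quant b φ.shift) := by
  cases b
  · exact eqv_ex_shift
  · exact eqv_all_shift

/-- Prenex formulas: `Σ_k` for the symbol `+`, `Π_k` for the symbol `-`. -/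
inductive IsPrenex : Sgn → ℕ → Formula → Prop
  | qf {b : Sgn} {φ : Formula} : φ.QF → IsPrenex b 0 φ
  | switch {b : Sgn} {k : ℕ} {φ : Formula} :
      IsPrenex b.flip k φ → IsPrenex b (k + 1) (quant b φ)
  | same {b : Sgn} {k : ℕ} {φ : Formula} :
      IsPrenex b (k + 1) φ → IsPrenex b (k + 1) (quant b φ)

/-- Induction along the outermost block of quantifiers. -/
theorem IsPrenex.block_induction {b : Sgn} {k : ℕ} {P : Formula → Prop} {φ : Formula}
    (h : IsPrenex b (k + 1) φ)
    (switch : ∀ φ, IsPrenex b.flip k φ → P (quant b φ))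
    (same : ∀ φ, IsPrenex b (k + 1) φ → P φ → P (quant b φ)) : P φ := by
  generalize hk : k + 1 = m at h
  induction h with
  | qf _ => omega
  | switch h _ =>
    obtain rfl := Nat.succ_injective hk
    exact switch _ h
  | same h ih =>
    obtain rfl := Nat.succ_injective hk
    exact same _ h (ih switch same rfl)

theorem IsPrenex.iterate {b : Sgn} {k n : ℕ} {φ : Formula} (h : IsPrenex b.flip k φ) :
    IsPrenex b (k + 1) ((quant b)^[n + 1] φ) := by
  induction n with
  | zero => exact .switch h
  | succ n ih =>
    rw [Function.iterate_succ_apply']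
    exact .same ih

theorem isPrenex_succ_iff {b : Sgn} {k : ℕ} {φ : Formula} : IsPrenex b (k + 1) φ ↔
    ∃ n : ℕ, ∃ ψ, IsPrenex b.flip k ψ ∧ φ = (quant b)^[n + 1] ψ := by
  refine ⟨fun h => ?_, fun ⟨n, ψ, h, e⟩ => e ▸ h.iterate⟩
  refine h.block_induction (P := fun φ => ∃ n : ℕ, ∃ ψ, IsPrenex b.flip k ψ ∧
    φ = (quant b)^[n + 1] ψ) (fun φ h => ⟨0, φ, h, rfl⟩) fun φ _ ⟨n, ψ, h, e⟩ => ⟨n + 1, ψ, h, ?_⟩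
  rw [e, ← Function.iterate_succ_apply' (quant b)]

theorem mem_classes_iff (k : ℕ) : (∀ φ, φ ∈ SigmaClass k ↔ IsPrenex Sgn.plus k φ) ∧
    ∀ φ, φ ∈ PiClass k ↔ IsPrenex Sgn.minus k φ := by
  induction k with
  | zero =>
    have h : ∀ b φ, φ.QF ↔ IsPrenex b 0 φ := fun b φ => ⟨.qf, fun h => by cases h; assumption⟩
    constructor
    · intro φ
      rw [← h, SigmaClass]
      rfl
    · intro φ
      rw [← h, PiClass]
      rfl
  | succ k ih =>
    constructor
    · intro φ
      rw [isPrenex_succ_iff, SigmaClass]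
      exact exists_congr fun n => exists_congr fun ψ => and_congr (ih.2 ψ) Iff.rfl
    · intro φ
      rw [isPrenex_succ_iff, PiClass]
      exact exists_congr fun n => exists_congr fun ψ => and_congr (ih.1 ψ) Iff.rfl

theorem mem_sigmaClass {k : ℕ} {φ : Formula} : φ ∈ SigmaClass k ↔ IsPrenex Sgn.plus k φ :=
  (mem_classes_iff k).1 φ

theorem mem_piClass {k : ℕ} {φ : Formula} : φ ∈ PiClass k ↔ IsPrenex Sgn.minus k φ :=
  (mem_classes_iff k).2 φ

theorem Formula.QF.subst {φ : Formula} (h : φ.QF) (σ : ℕ → Term) : (φ.subst σ).QF := by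
  induction φ generalizing σ with
  | bot | eq t u => trivial
  | and φ ψ h₁ h₂ | or φ ψ h₁ h₂ | imp φ ψ h₁ h₂ => exact ⟨h₁ h.1 σ, h₂ h.2 σ⟩
  | all φ _ | ex φ _ => exact h.elim

namespace IsPrenex

variable {T : Set Formula} {b : Sgn} {k m : ℕ} {φ ψ : Formula}

theorem subst (h : IsPrenex b k φ) (σ : ℕ → Term) : IsPrenex b k (φ.subst σ) := by
  induction h generalizing σ with
  | qf h => exact .qf (h.subst σ)
  | switch _ ih =>
    rw [subst_quant]
    exact .switch (ih _)
  | same _ ih =>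
    rw [subst_quant]
    exact .same (ih _)

theorem shift (h : IsPrenex b k φ) : IsPrenex b k φ.shift := h.subst _

/-- A dummy quantifier is added innermost, around the quantifier-free matrix, so the outermost
symbol is kept. -/
theorem exists_succ (T : Set Formula) (h : IsPrenex b k φ) :
    ∃ ψ, IsPrenex b (k + 1) ψ ∧ ψ.fv = φ.fv ∧ Eqv T φ ψ := by
  induction h with
  | @qf b φ h =>
    exact ⟨quant b φ.shift, .switch (.qf (h.subst _)), fv_quant_shift b φ, eqv_quant_shift b⟩
  | switch h ih =>
    obtain ⟨ψ, hψ, hfv, he⟩ := ih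
    exact ⟨_, .switch hψ, by rw [fv_quant, fv_quant, hfv], he.quant _⟩
  | same h ih =>
    obtain ⟨ψ, hψ, hfv, he⟩ := ih
    exact ⟨_, .same hψ, by rw [fv_quant, fv_quant, hfv], he.quant _⟩

theorem exists_of_le (T : Set Formula) (h : IsPrenex b k φ) (hkm : k ≤ m) :
    ∃ ψ, IsPrenex b m ψ ∧ ψ.fv = φ.fv ∧ Eqv T φ ψ := by
  induction m, hkm using Nat.le_induction with
  | base => exact ⟨φ, h, rfl, .refl⟩
  | succ m _ ih =>
    obtain ⟨ψ, hψ, hfv, he⟩ := ih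
    obtain ⟨χ, hχ, hfv', he'⟩ := hψ.exists_succ T
    exact ⟨χ, hχ, hfv'.trans hfv, he.trans he'⟩

end IsPrenex

-- Stable and decidable levels

/-- Double negation elimination for all prenex formulas up to level `m`. -/
def StableUpTo (T : Set Formula) (m : ℕ) : Prop :=
  ∀ b k φ, k ≤ m → IsPrenex b k φ → Provable T (Formula.imp φ.neg.neg φ)

/-- Excluded middle for all prenex formulas up to level `m`. -/
def DecidableUpTo (T : Set Formula) (m : ℕ) : Prop :=
  ∀ b k φ, k ≤ m → IsPrenex b k φ → Provable T (Formula.or φ φ.neg)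

section

variable {T : Set Formula} {b : Sgn} {k m : ℕ} {A φ ψ : Formula}

theorem DecidableUpTo.stableUpTo (h : DecidableUpTo T m) : StableUpTo T m :=
  fun b k φ hk hφ => provable_stable_of_em (h b k φ hk hφ)

theorem stableUpTo_PA (m : ℕ) : StableUpTo PA m :=
  fun _ _ φ _ _ => provable_stable_of_em (em_PA φ)

theorem provable_congr {φ ψ : Formula} (h : Eqv T φ ψ) : Provable T φ ↔ Provable T ψ := by
  simp only [provable_iff_holds]
  exact forall_congr' fun Γ => forall_congr' fun σ => h Γ σ

/-- The negation of a prenex formula is equivalent to the dual prenex formula. -/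
theorem IsPrenex.exists_neg (hT : StableUpTo T m) (h : IsPrenex b k φ) (hk : k ≤ m) :
    ∃ ψ, IsPrenex b.flip k ψ ∧ ψ.fv = φ.fv ∧ Eqv T ψ φ.neg := by
  have key : ∀ {b : Sgn} {φ ψ : Formula} (k : ℕ), k ≤ m → IsPrenex b.flip k (quant b.flip ψ) →
      Provable T (Formula.imp φ.neg.neg φ) → Eqv T ψ φ.neg →
      Eqv T (quant b.flip ψ) (quant b φ).neg := by
    intro b φ ψ k hk hq hφ he
    cases b with
    | plus => exact he.all.trans eqv_not_ex.symm
    | minus =>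
      intro Γ σ
      constructor
      · exact fun H => holds_imp.2 fun Δ hΔ h => (H.mono hΔ).exE fun E hE t H =>
          (((he _ _).1 H).mp ((holds_all.1 h t).mono hE)).botE
      -- Passing from `¬∀` to `∃¬` is the nonconstructive direction; it uses stability of the
      -- resulting existential formula and of the matrix.
      · refine fun H => Holds.of_neg_neg (hT _ _ _ hk hq) fun Δ hΔ hn => ?_
        refine H.mp' hΔ (holds_all.2 fun t => Holds.of_neg_neg hφ fun E hE h => ?_)
        exact (hn.mp' hE (.exI t ((he _ _).2 h))).botE
  induction h with
  | @qf b φ h => exact ⟨φ.neg, .qf ⟨h, trivial⟩, Set.union_empty _, .refl⟩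
  | @switch b k φ h ih =>
    obtain ⟨ψ, hψ, hfv, he⟩ := ih (by omega)
    have hq : IsPrenex b.flip (k + 1) (quant b.flip ψ) := .switch hψ
    exact ⟨_, hq, by rw [fv_quant, fv_quant, hfv],
      key _ hk hq (hT _ _ _ (by omega) h) he⟩
  | same h ih =>
    obtain ⟨ψ, hψ, hfv, he⟩ := ih hk
    exact ⟨_, .same hψ, by rw [fv_quant, fv_quant, hfv],
      key _ hk (.same hψ) (hT _ _ _ hk h) he⟩


/-- Double negation elimination for existential prenex formulas suffices for all of them. -/
theorem StableUpTo.of_sigma (hT : ExtendsHA T)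
    (h : ∀ k φ, k ≤ m → IsPrenex Sgn.plus k φ → Provable T (Formula.imp φ.neg.neg φ)) :
    StableUpTo T m := by
  -- Stability passes through universal quantifiers for free, so `Π_{k+1}` inherits it from `Σ_k`.
  have hall : ∀ {φ}, Provable T (Formula.imp φ.neg.neg φ) →
      Provable T (Formula.imp φ.all.neg.neg φ.all) := by
    refine fun {φ} hφ => provable_imp_iff.2 fun Γ σ H => holds_all.2 fun t =>
      Holds.of_neg_neg hφ fun Δ hΔ hn => ?_
    exact H.mp' hΔ (holds_imp.2 fun E hE h' => hn.mp' hE (holds_all.1 h' t))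
  intro b k φ hk hφ
  cases b with
  | plus => exact h k φ hk hφ
  | minus =>
    cases k with
    | zero =>
      cases hφ with
      | qf hφ => exact provable_stable_of_em (provable_iff_holds.2 fun _ _ => hT.qf_em hφ)
    | succ k =>
      exact hφ.block_induction (P := fun φ => Provable T (Formula.imp φ.neg.neg φ))
        (fun φ hφ => hall (h k φ (by omega) hφ)) (fun φ _ hφ => hall hφ)

/-- A `Σ` formula is decided by its dual `Π` formula, which is equivalent to its negation; if the
dual fails, stability gives the formula back. -/
theorem DecidableUpTo.of_pi (h : StableUpTo T m)
    (hm : ∀ φ, IsPrenex Sgn.minus m φ → Provable T (Formula.or φ φ.neg)) :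
    DecidableUpTo T m := by
  have hpi : ∀ k φ, k ≤ m → IsPrenex Sgn.minus k φ → Provable T (Formula.or φ φ.neg) := by
    intro k φ hk hφ
    obtain ⟨ψ, hψ, -, he⟩ := hφ.exists_of_le T hk
    exact (provable_congr (he.or he.neg)).2 (hm ψ hψ)
  intro b k φ hk hφ
  cases b with
  | minus => exact hpi k φ hk hφ
  | plus =>
    obtain ⟨ψ, hψ, -, he⟩ := hφ.exists_neg h hk
    refine provable_iff_holds.2 fun Γ σ => Holds.by_cases (hpi k ψ hk hψ)
      (fun Δ _ hψ => ((he _ _).1 hψ).inr) fun Δ _ hn => .inl ?_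
    exact (Holds.of_provable (h _ k φ hk hφ)).mp ((he.neg _ _).1 hn)

-- Translating prenex formulas; conservativity

theorem eqv_tr_of_eqv_PA (hT : ExtendsHA T) (h : Eqv PA φ ψ) (A : Formula) :
    Eqv T (tr A φ) (tr A ψ) :=
  eqv_iff.2 (tr_provable hT (eqv_iff.1 h) A)

theorem eqv_tr_of_qf (hT : ExtendsHA T) (hφ : φ.QF) (A : Formula) :
    Eqv T (tr A φ) (Formula.or φ A) := by
  have em : ∀ {φ : Formula}, φ.QF → Provable T (Formula.or φ φ.neg) := fun h =>
    provable_iff_holds.2 fun _ _ => hT.qf_em h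
  induction φ with
  | bot => exact fun _ _ => ⟨Holds.inr, fun h => h.orE (fun _ _ h => h.botE) fun _ _ h => h⟩
  | eq t u => exact .refl
  | and φ ψ h₁ h₂ =>
    refine ((h₁ hφ.1).and (h₂ hφ.2)).trans fun Γ σ => ⟨fun h => ?_, fun h => ?_⟩
    · refine (holds_and.1 h).1.orE (fun Δ hΔ h₁ => ?_) fun _ _ h => h.inr
      exact ((holds_and.1 h).2.mono hΔ).orE
        (fun E hE h₂ => .inl (holds_and.2 ⟨h₁.mono hE, h₂⟩)) fun _ _ h => h.inr
    · exact holds_and.2 ⟨h.or_mono (fun _ _ h => (holds_and.1 h).1) fun _ _ h => h,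
        h.or_mono (fun _ _ h => (holds_and.1 h).2) fun _ _ h => h⟩
  | or φ ψ h₁ h₂ =>
    refine (((h₁ hφ.1).or (h₂ hφ.2)).imp .refl |>.imp .refl).trans fun Γ σ =>
      ⟨fun h => ?_, fun h => h.orE (fun _ _ h => ?_) fun _ _ h => ?_⟩
    · refine Holds.by_cases (em hφ) (fun _ _ h => h.inl) fun Δ hΔ hn => .inr ?_
      refine h.mp' hΔ (holds_imp.2 fun E hE h => h.orE (fun F hF h => ?_) fun F hF h => ?_)
      · exact h.orE (fun G hG h => (hn.mp' (List.Subset.trans hE (List.Subset.trans hF hG))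
          h.inl).botE) fun _ _ h => h
      · exact h.orE (fun G hG h => (hn.mp' (List.Subset.trans hE (List.Subset.trans hF hG))
          h.inr).botE) fun _ _ h => h
    · exact Holds.dneg (h.or_mono (fun _ _ h => h.inl) fun _ _ h => h.inl)
    · exact Holds.dneg h.inr.inl
  | imp φ ψ h₁ h₂ =>
    refine ((h₁ hφ.1).imp (h₂ hφ.2)).trans fun Γ σ => ⟨fun h => ?_, fun h => ?_⟩
    · refine Holds.by_cases (em hφ.1) (fun Δ hΔ h₁ => ?_) fun Δ _ hn =>
        .inl (holds_imp.2 fun E hE h₁ => (hn.mp' hE h₁).botE)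
      exact (h.mp' hΔ h₁.inl).or_mono (fun E hE h₂ => holds_imp.2 fun F hF _ => h₂.mono hF)
        fun _ _ h => h
    · refine h.orE (fun Δ hΔ h => holds_imp.2 fun E hE h' => ?_) fun Δ hΔ h =>
        holds_imp.2 fun E hE _ => (h.mono hE).inr
      exact h'.or_mono (fun F hF h' => h.mp' (List.Subset.trans hE hF) h') fun _ _ h => h
  | all φ _ | ex φ _ => exact hφ.elim

/-- For decidable prenex formulas, the relativized translation only adds a disjunct. -/
theorem IsPrenex.eqv_tr (hT : ExtendsHA T) (hd : DecidableUpTo T m) (h : IsPrenex b k φ)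
    (hk : k ≤ m) (A : Formula) : Eqv T (tr A φ) (Formula.or φ A) := by
  -- The pair `b'`, `k'` describes the matrix, so that one argument covers both a change of
  -- quantifier and a continued block.
  have key : ∀ {b b' : Sgn} {φ : Formula} (k k' : ℕ) (A : Formula), k ≤ m → k' ≤ m →
      IsPrenex b k (quant b φ) → IsPrenex b' k' φ →
      (∀ ψ, IsPrenex b'.flip k' ψ → IsPrenex b.flip k (quant b.flip ψ)) →
      (∀ A, Eqv T (tr A φ) (Formula.or φ A)) →
      Eqv T (tr A (quant b φ)) (Formula.or (quant b φ) A) := by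
    intro b b' φ k k' A hk hk' hq hφ hdual he
    cases b with
    | plus =>
      refine ((((he A.shift).ex).imp .refl).imp .refl).trans fun Γ σ => ⟨fun h => ?_, fun h => ?_⟩
      · refine Holds.by_cases (hd _ _ _ hk hq) (fun _ _ h => h.inl) fun Δ hΔ hn => .inr ?_
        refine h.mp' hΔ (holds_imp.2 fun E hE h => h.exE fun F hF t h => h.orE
          (fun G hG h => ?_) fun G hG h => holds_shift.1 h)
        exact (hn.mp' (List.Subset.trans hE (List.Subset.trans hF hG)) (.exI t h)).botE
      · exact Holds.dneg (h.orE (fun Δ _ h => h.ex_mono fun _ _ _ h => h.inl)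
          fun _ _ h => .exI Term.zero (holds_shift.2 h).inr)
    | minus =>
      refine ((he A.shift).all).trans fun Γ σ => ⟨fun h => ?_, fun h => ?_⟩
      -- From `∀(φ ∨ A)` to `∀φ ∨ A`: decide `∃¬φ`, in the dual prenex form. A counterexample yields
      -- `A`; its absence yields `∀φ` by stability.
      · obtain ⟨ψ, hψ, -, hneg⟩ := hφ.exists_neg hd.stableUpTo hk'
        refine Holds.by_cases (hd _ _ _ hk (hdual ψ hψ)) (fun Δ hΔ h' => .inr ?_)
          fun Δ hΔ hn => .inl (holds_all.2 fun t =>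
            Holds.of_neg_neg (hd.stableUpTo _ _ _ hk' hφ) fun E hE h' =>
              hn.mp' hE (.exI t ((hneg _ _).2 h')))
        exact h'.exE fun E hE t h' => (((holds_all.1 h t).mono hΔ).mono hE).orE
          (fun F hF h'' => (((hneg _ _).1 h').mp' hF h'').botE) fun _ _ h => holds_shift.1 h
      · exact holds_all.2 fun t => h.orE (fun _ _ h => (holds_all.1 h t).inl)
          fun _ _ h => (holds_shift.2 h).inr
  induction h generalizing A with
  | qf h => exact eqv_tr_of_qf hT h A
  | switch h ih =>
    exact key _ _ A hk (by omega) (.switch h) h (fun ψ hψ => .switch hψ) (ih (by omega))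
  | same h ih =>
    exact key _ _ A hk hk (.same h) h (fun ψ hψ => .same hψ) (ih hk)

/-- The negative translation does not change stable prenex formulas. -/
theorem IsPrenex.eqv_tr_bot (hT : ExtendsHA T) (hs : ∀ i < m, StableUpTo T i)
    (h : IsPrenex b k φ) (hk : k ≤ m) (hb : b = Sgn.plus → k < m) :
    Eqv T (tr bot φ) φ := by
  have key : ∀ {b : Sgn} {φ : Formula} (k : ℕ), (b = Sgn.plus → k < m) →
      IsPrenex b k (quant b φ) → Eqv T (tr bot φ) φ →
      Eqv T (tr bot (quant b φ)) (quant b φ) := by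
    intro b φ k hk hq he
    cases b with
    | plus =>
      -- Only existential quantifiers acquire a double negation, and the side condition keeps their
      -- level below `m`, where stability removes it.
      exact (he.ex.imp .refl |>.imp .refl).trans fun Γ σ =>
        ⟨(Holds.of_provable (hs k (hk rfl) _ _ _ le_rfl hq)).mp, Holds.neg_neg⟩
    | minus => exact he.all
  induction h with
  | qf h =>
    exact (eqv_tr_of_qf hT h bot).trans fun _ _ =>
      ⟨fun h => h.orE (fun _ _ h => h) fun _ _ h => h.botE, Holds.inl⟩
  | switch h ih => exact key _ hb (.switch h) (ih (by omega) fun _ => by omega)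
  | same h ih => exact key _ hb (.same h) (ih hk hb)

/-- At one level above the decidable ones, `φ` implies its translation, which in turn implies
the relativized double negation of `φ`. -/
theorem IsPrenex.tr_sigma (hT : ExtendsHA T) (hd : DecidableUpTo T m)
    (h : IsPrenex Sgn.plus (m + 1) φ) (A : Formula) :
    Provable T (Formula.imp φ (tr A φ)) ∧ Provable T (Formula.imp (tr A φ) (dneg A φ)) := by
  have key : ∀ {φ : Formula}, (∀ A, Provable T (Formula.imp φ (tr A φ)) ∧
      Provable T (Formula.imp (tr A φ) (dneg A φ))) → ∀ A,
      Provable T (Formula.imp φ.ex (tr A φ.ex)) ∧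
        Provable T (Formula.imp (tr A φ.ex) (dneg A φ.ex)) := by
    intro φ h A
    have h₁ := provable_imp_iff.1 (h A.shift).1
    have h₂ := provable_imp_iff.1 (h A.shift).2
    refine ⟨provable_imp_iff.2 fun Γ σ H => Holds.dneg (H.ex_mono fun Δ _ t => h₁ Δ _),
      provable_imp_iff.2 fun Γ σ H => holds_imp.2 fun Δ hΔ hn => H.mp' hΔ (holds_imp.2
        fun E hE H' => H'.exE fun F hF t H' => ?_)⟩
    exact holds_shift.1 ((h₂ F _ H').mp (holds_imp.2 fun G hG h =>
      holds_shift.2 (hn.mp' (List.Subset.trans hE (List.Subset.trans hF hG)) (.exI t h))))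
  refine h.block_induction (P := fun φ => ∀ A, Provable T (Formula.imp φ (tr A φ)) ∧
    Provable T (Formula.imp (tr A φ) (dneg A φ))) (fun φ hφ => key fun A => ?_)
    (fun φ _ h => key h) A
  have he := hφ.eqv_tr hT hd le_rfl A
  refine ⟨provable_imp_iff.2 fun Γ σ h => (he _ _).2 h.inl, provable_imp_iff.2 fun Γ σ h =>
    holds_imp.2 fun Δ hΔ hn => (((he _ _).1 h).mono hΔ).orE (fun E hE => hn.mp' hE)
      fun _ _ h => h⟩

/-- The translation commutes with `∀`, so the first half of `IsPrenex.tr_sigma` extends over one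
more universal block. The premise of an implication needs no converse. -/
theorem IsPrenex.imp_tr_pi (hT : ExtendsHA T) (hd : DecidableUpTo T m)
    (h : IsPrenex Sgn.minus (m + 2) φ) (A : Formula) : Provable T (Formula.imp φ (tr A φ)) := by
  have key : ∀ {φ : Formula}, (∀ A, Provable T (Formula.imp φ (tr A φ))) → ∀ A,
      Provable T (Formula.imp φ.all (tr A φ.all)) := fun h A =>
    provable_imp_iff.2 fun Γ σ H => holds_all.2 fun t =>
      provable_imp_iff.1 (h A.shift) _ _ (holds_all.1 H t)
  exact h.block_induction (P := fun φ => ∀ A, Provable T (Formula.imp φ (tr A φ)))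
    (fun φ hφ => key fun A => (hφ.tr_sigma hT hd A).1) (fun φ _ h => key h) A

/-- Classical arithmetic is conservative for implications from `Π_{m+2}` to `Σ_{m+1}`. -/
theorem conservative_pi_sigma (hT : ExtendsHA T) (hd : DecidableUpTo T m)
    (hφ : IsPrenex Sgn.minus (m + 2) φ) (hψ : IsPrenex Sgn.plus (m + 1) ψ)
    (h : Provable PA (Formula.imp φ ψ)) : Provable T (Formula.imp φ ψ) := by
  -- Friedman's trick: with `A := ψ`, the chain `φ → tr ψ φ → tr ψ ψ → ((ψ → ψ) → ψ)` ends in `ψ`.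
  have h₁ := provable_imp_iff.1 (hφ.imp_tr_pi hT hd ψ)
  have h₂ := provable_imp_iff.1 (tr_provable hT h ψ)
  have h₃ := provable_imp_iff.1 (hψ.tr_sigma hT hd ψ).2
  exact provable_imp_iff.2 fun Γ σ H => (h₃ _ _ (h₂ _ _ (h₁ _ _ H))).mp
    (holds_imp.2 fun _ _ h => h)

end

-- Alternation paths and the classes `U_k⁺`

section Alternation

variable {b : Sgn} {k m : ℕ} {φ ψ : Formula}

theorem head_prepend (b : Sgn) (s : List Sgn) : (prepend b s).head? = some b := by
  unfold prepend
  split_ifs with h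
  · exact h
  · rfl

theorem length_prepend_le (b : Sgn) (s : List Sgn) : s.length ≤ (prepend b s).length := by
  unfold prepend
  split_ifs <;> simp

theorem alt_quant (b : Sgn) (φ : Formula) : alt (quant b φ) = (alt φ).image (prepend b) := by
  cases b <;> simp [quant, alt]

theorem alt_imp (φ ψ : Formula) : alt (imp φ ψ) = (alt φ).image (List.map Sgn.flip) ∨
    alt (imp φ ψ) = (alt φ).image (List.map Sgn.flip) ∪ alt ψ := by
  cases ψ <;> simp [alt]

theorem alt_imp_of_ne_bot (hψ : ψ ≠ bot) :
    alt (imp φ ψ) = (alt φ).image (List.map Sgn.flip) ∪ alt ψ := by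
  cases ψ <;> simp_all [alt]

theorem image_flip_subset_alt_imp : (alt φ).image (List.map Sgn.flip) ⊆ alt (imp φ ψ) := by
  rcases alt_imp φ ψ with h | h <;> rw [h]
  exact Finset.subset_union_left

theorem alt_nonempty (φ : Formula) : (alt φ).Nonempty := by
  induction φ with
  | bot | eq t u => exact ⟨[], by simp [alt]⟩
  | and φ ψ h _ | or φ ψ h _ => exact h.mono (by simp [alt])
  | imp φ ψ h _ => exact (h.image _).mono image_flip_subset_alt_imp
  | all φ h | ex φ h => exact (h.image _)

theorem alt_subst (φ : Formula) (σ : ℕ → Term) : alt (φ.subst σ) = alt φ := by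
  induction φ generalizing σ with
  | bot | eq t u => rfl
  | and φ ψ h₁ h₂ | or φ ψ h₁ h₂ => simp only [Formula.subst, alt, h₁, h₂]
  | imp φ ψ h₁ h₂ =>
    by_cases hψ : ψ = bot
    · subst hψ
      simp only [Formula.subst, alt, h₁]
    · have hψ' : ψ.subst σ ≠ bot := by
        cases ψ <;> simp_all [Formula.subst]
      rw [Formula.subst, alt_imp_of_ne_bot hψ, alt_imp_of_ne_bot hψ', h₁, h₂]
  | all φ h | ex φ h => simp only [Formula.subst, alt, h]

/-- All alternation paths have length at most `k`, and those of length `k` do not begin with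
the symbol opposite to `b`. -/
def Within (b : Sgn) (k : ℕ) (φ : Formula) : Prop :=
  ∀ s ∈ alt φ, s.length ≤ k ∧ (s.head? = some b.flip → s.length < k)

theorem Within.mono (h : Within b k φ) (hk : k ≤ m) : Within b m φ := fun s hs =>
  ⟨(h s hs).1.trans hk, fun hb => ((h s hs).2 hb).trans_le hk⟩

theorem Within.subst (h : Within b k φ) (σ : ℕ → Term) : Within b k (φ.subst σ) := by
  unfold Within
  rwa [alt_subst]

theorem within_bot : Within b k bot := by
  simp [Within, alt]

theorem within_eq {t u : Term} : Within b k (eq t u) := by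
  simp [Within, alt]

theorem within_and : Within b k (and φ ψ) ↔ Within b k φ ∧ Within b k ψ := by
  simp only [Within, alt, Finset.mem_union]
  exact ⟨fun h => ⟨fun s hs => h s (.inl hs), fun s hs => h s (.inr hs)⟩,
    fun h s hs => hs.elim (h.1 s) (h.2 s)⟩

theorem within_or : Within b k (or φ ψ) ↔ Within b k φ ∧ Within b k ψ := within_and

theorem Within.left_of_imp (h : Within b k (imp φ ψ)) : Within b.flip k φ := by
  intro s hs
  have := h _ (image_flip_subset_alt_imp (Finset.mem_image_of_mem _ hs))
  rw [List.length_map] at this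
  refine ⟨this.1, fun hb => this.2 ?_⟩
  rw [List.head?_map, hb]
  simp

theorem Within.right_of_imp (h : Within b k (imp φ ψ)) : Within b k ψ := by
  by_cases hψ : ψ = bot
  · rw [hψ]
    exact within_bot
  · intro s hs
    refine h s ?_
    rw [alt_imp_of_ne_bot hψ]
    exact Finset.mem_union_right _ hs

theorem within_imp (hφ : Within b.flip k φ) (hψ : Within b k ψ) : Within b k (imp φ ψ) := by
  have h₁ : ∀ s ∈ (alt φ).image (List.map Sgn.flip),
      s.length ≤ k ∧ (s.head? = some b.flip → s.length < k) := by
    intro s hs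
    obtain ⟨r, hr, rfl⟩ := Finset.mem_image.1 hs
    rw [List.length_map]
    refine ⟨(hφ r hr).1, fun hb => (hφ r hr).2 ?_⟩
    cases r with
    | nil => simp at hb
    | cons a r =>
      have hb : a.flip = b.flip := by simpa using hb
      rw [← hb, a.flip_flip, List.head?_cons]
  intro s hs
  rcases alt_imp φ ψ with h | h <;> rw [h] at hs
  · exact h₁ s hs
  · exact (Finset.mem_union.1 hs).elim (h₁ s) (hψ s)

/-- Prefixing `b` lengthens only the empty path, whence `1 ≤ k`, and paths beginning with the
opposite symbol, which are one step shorter than the bound. -/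
theorem within_quant : Within b k (quant b φ) ↔ 1 ≤ k ∧ Within b k φ := by
  unfold Within
  rw [alt_quant]
  constructor
  · intro h
    have hne : ∀ s : List Sgn, s.head? = some b.flip → (prepend b s).length = s.length + 1 := by
      intro s hs
      rw [prepend, if_neg]
      · rfl
      · rw [hs]
        simpa using b.flip_ne
    constructor
    · obtain ⟨s, hs⟩ := alt_nonempty φ
      refine le_trans ?_ (h _ (Finset.mem_image_of_mem _ hs)).1
      have := head_prepend b s
      cases hp : prepend b s with
      | nil => simp [hp] at this
      | cons => simp
    · intro s hs
      have h' := (h _ (Finset.mem_image_of_mem _ hs)).1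
      exact ⟨(length_prepend_le b s).trans h', fun hb => by rw [hne s hb] at h'; omega⟩
  · rintro ⟨hk, h⟩ s hs
    obtain ⟨r, hr, rfl⟩ := Finset.mem_image.1 hs
    refine ⟨?_, fun hb => ?_⟩
    · unfold prepend
      split_ifs with hb
      · exact (h r hr).1
      · rw [List.length_cons]
        cases r with
        | nil => simpa using hk
        | cons a r =>
          refine (h _ hr).2 ?_
          rcases a.eq_or_eq_flip b with rfl | rfl
          · simp at hb
          · rfl
    · rw [head_prepend] at hb
      exact absurd (Option.some.inj hb).symm b.flip_ne

/-- All paths of such a formula begin with the opposite symbol, so none attains length `k`; the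
formula belongs to the dual class one level down. -/
theorem Within.exists_of_quant_flip (h : Within b k (quant b.flip φ)) :
    ∃ l, k = l + 1 ∧ Within b.flip l (quant b.flip φ) := by
  have hlt : ∀ s ∈ alt (quant b.flip φ), s.head? = some b.flip := by
    intro s hs
    rw [alt_quant] at hs
    obtain ⟨s, hs, rfl⟩ := Finset.mem_image.1 hs
    exact head_prepend _ _
  obtain ⟨s, hs⟩ := alt_nonempty (quant b.flip φ)
  obtain ⟨l, rfl⟩ := Nat.exists_eq_succ_of_ne_zero (Nat.ne_zero_of_lt ((h s hs).2 (hlt s hs)))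
  refine ⟨l, rfl, fun s hs => ⟨Nat.le_of_lt_succ ((h s hs).2 (hlt s hs)), fun hb => ?_⟩⟩
  rw [hlt s hs] at hb
  exact absurd (Option.some.inj hb).symm (Sgn.flip_ne _)

/-- The matrix of a quantified formula lies in the class that begins with the quantifier. -/
theorem Within.of_quant {a : Sgn} (h : Within b k (quant a φ)) : 1 ≤ k ∧ Within a k φ := by
  rcases a.eq_or_eq_flip b with rfl | rfl
  · exact within_quant.1 h
  · obtain ⟨l, rfl, h'⟩ := h.exists_of_quant_flip
    exact ⟨by omega, (within_quant.1 h').2.mono (Nat.le_succ l)⟩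

theorem Within.qf (h : Within b 0 φ) : φ.QF := by
  induction φ generalizing b with
  | bot | eq t u => trivial
  | and φ ψ h₁ h₂ | or φ ψ h₁ h₂ => exact ⟨h₁ (within_and.1 h).1, h₂ (within_and.1 h).2⟩
  | imp φ ψ h₁ h₂ => exact ⟨h₁ h.left_of_imp, h₂ h.right_of_imp⟩
  | all φ _ => exact absurd (Within.of_quant (a := Sgn.minus) h).1 (by omega)
  | ex φ _ => exact absurd (Within.of_quant (a := Sgn.plus) h).1 (by omega)

theorem IsPrenex.within (h : IsPrenex b k φ) : Within b k φ := by
  induction h with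
  | @qf b φ h =>
    induction φ generalizing b with
    | bot => exact within_bot
    | eq t u => exact within_eq
    | and φ ψ h₁ h₂ | or φ ψ h₁ h₂ => exact within_and.2 ⟨h₁ h.1, h₂ h.2⟩
    | imp φ ψ h₁ h₂ =>
      exact within_imp (h₁ h.1) (h₂ h.2)
    | all φ _ | ex φ _ => exact h.elim
  | switch h ih =>
    exact within_quant.2 ⟨by omega, fun s hs =>
      ⟨(ih s hs).1.trans (Nat.le_succ _), fun _ => Nat.lt_succ_of_le (ih s hs).1⟩⟩
  | same h ih => exact within_quant.2 ⟨by omega, ih⟩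

theorem degree_le (h : Within b k φ) : degree φ ≤ k := Finset.sup_le fun s hs => (h s hs).1

theorem length_le_degree {s : List Sgn} (hs : s ∈ alt φ) : s.length ≤ degree φ :=
  Finset.le_sup (f := List.length) hs

/-- Membership in `U_k⁺`, unlike having exact degree `k`, can be followed through subformulas, with
the symbol flipped in the premise of an implication. -/
theorem mem_uPlusClass : φ ∈ UPlusClass k ↔ Within Sgn.minus k φ := by
  constructor
  · rintro (h | h)
    · cases k with
      | zero =>
        intro s hs
        have := length_le_degree hs
        rw [show degree φ = 0 from h] at this
        obtain rfl : s = [] := List.length_eq_zero_iff.1 (Nat.le_zero.1 this)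
        simp
      | succ k =>
        intro s hs
        have hle : s.length ≤ k + 1 := (length_le_degree hs).trans_eq h.1
        refine ⟨hle, fun hb => lt_of_le_of_ne hle fun he => ?_⟩
        rw [h.2 s hs he] at hb
        cases hb
    · simp only [Set.mem_iUnion] at h
      obtain ⟨i, hi, h⟩ := h
      intro s hs
      have : s.length ≤ i := (length_le_degree hs).trans_eq h
      exact ⟨by omega, fun _ => by omega⟩
  · intro h
    rcases (degree_le h).lt_or_eq with hlt | he
    · exact .inr (Set.mem_iUnion₂.2 ⟨_, hlt, rfl⟩)
    · refine .inl ?_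
      cases k with
      | zero => exact he
      | succ k =>
        refine ⟨he, fun s hs hl => ?_⟩
        cases s with
        | nil => simp at hl
        | cons a s =>
          cases a with
          | minus => rfl
          | plus => exact absurd ((h _ hs).2 rfl) (by omega)

/-- A formula of `U_k⁺` need not lie in any `U_l`, but after a universal quantifier all its paths
begin with `-`, so it lies in `U_l` for its own degree `l`. -/
theorem Within.exists_mem_uClass (h : Within Sgn.minus k (all φ)) :
    ∃ l ≤ k, all φ ∈ UClass l := by
  refine ⟨degree (all φ), degree_le h, ?_⟩
  have hm : all φ ∈ UPlusClass (degree (all φ)) := mem_uPlusClass.2 fun s hs => by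
    refine ⟨length_le_degree hs, fun hb => ?_⟩
    obtain ⟨s, _, rfl⟩ := Finset.mem_image.1 (show s ∈ (alt φ).image (prepend Sgn.minus) from hs)
    rw [head_prepend] at hb
    cases hb
  rcases hm with hm | hm
  · exact hm
  · simp only [Set.mem_iUnion] at hm
    obtain ⟨i, hi, h'⟩ := hm
    exact absurd hi (by rw [show degree (all φ) = i from h']; omega)

end Alternation

-- Prenex normal forms in classical arithmetic

section ClassicalPrenex

variable {b : Sgn} {k m : ℕ} {φ ψ χ : Formula}

theorem Holds.em {Γ : List Formula} {σ : ℕ → Term} (φ : Formula) :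
    Holds PA Γ σ (Formula.or φ φ.neg) := .of_provable (em_PA φ)

theorem eqv_imp_or : Eqv PA (imp φ ψ) (Formula.or φ.neg ψ) := fun _ _ =>
  ⟨fun h => (Holds.em φ).orE (fun _ hΔ hφ => (h.mp' hΔ hφ).inr) fun _ _ h => h.inl,
    fun h => h.orE (fun _ _ h => holds_imp.2 fun _ hΔ hφ => (h.mp' hΔ hφ).botE)
      fun _ _ h => holds_imp.2 fun _ hΔ _ => h.mono hΔ⟩

/-- A binary connective that commutes classically with quantifiers. -/
structure Prenexable (op : Formula → Formula → Formula) : Prop where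
  qf : ∀ {φ ψ}, φ.QF → ψ.QF → (op φ ψ).QF
  fv : ∀ φ ψ, (op φ ψ).fv = φ.fv ∪ ψ.fv
  comm : ∀ φ ψ, Eqv PA (op φ ψ) (op ψ φ)
  quant : ∀ b φ ψ, Eqv PA (op (quant b φ) ψ) (quant b (op φ ψ.shift))

theorem prenexable_and : Prenexable and where
  qf h h' := ⟨h, h'⟩
  fv _ _ := rfl
  comm _ _ _ _ := holds_and.trans (And.comm.trans holds_and.symm)
  quant b φ ψ Γ σ := by
    cases b with
    | plus =>
      refine ⟨fun h => (holds_and.1 h).1.ex_mono fun Δ hΔ t h' => holds_and.2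
        ⟨h', holds_shift.2 ((holds_and.1 h).2.mono hΔ)⟩, fun h => h.exE fun Δ hΔ t h => ?_⟩
      exact holds_and.2 ⟨.exI t (holds_and.1 h).1, holds_shift.1 (holds_and.1 h).2⟩
    | minus =>
      refine ⟨fun h => holds_all.2 fun t => holds_and.2
        ⟨holds_all.1 (holds_and.1 h).1 t, holds_shift.2 (holds_and.1 h).2⟩, fun h => ?_⟩
      exact holds_and.2 ⟨holds_all.2 fun t => (holds_and.1 (holds_all.1 h t)).1,
        holds_shift.1 (holds_and.1 (holds_all.1 h Term.zero)).2⟩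

theorem prenexable_or : Prenexable Formula.or where
  qf h h' := ⟨h, h'⟩
  fv _ _ := rfl
  comm _ _ _ _ := ⟨fun h => h.orE (fun _ _ h => h.inr) fun _ _ h => h.inl,
    fun h => h.orE (fun _ _ h => h.inr) fun _ _ h => h.inl⟩
  quant b φ ψ Γ σ := by
    cases b with
    | plus =>
      refine ⟨fun h => h.orE (fun Δ _ h => h.ex_mono fun _ _ _ h => h.inl)
        fun Δ _ h => .exI Term.zero (holds_shift.2 h).inr, fun h => h.exE fun Δ hΔ t h => ?_⟩
      exact h.orE (fun _ _ h => .inl (.exI t h)) fun _ _ h => .inr (holds_shift.1 h)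
    | minus =>
      refine ⟨fun h => holds_all.2 fun t => h.or_mono (fun _ _ h => holds_all.1 h t)
        fun _ _ h => holds_shift.2 h, fun h => (Holds.em ψ).orE (fun _ _ h => h.inr)
          fun Δ hΔ hn => .inl (holds_all.2 fun t => ?_)⟩
      exact ((holds_all.1 h t).mono hΔ).orE (fun _ _ h => h)
        fun E hE h => (hn.mp' hE (holds_shift.1 h)).botE

theorem fv_quant_union_shift (h : χ.fv = φ.fv ∪ ψ.shift.fv) : (quant b χ).fv = (quant b φ).fv ∪ ψ.fv := by
  rw [fv_quant, fv_quant, h]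
  ext i
  simp [succ_mem_fv_shift]

/-- Prenex formulas can be merged under a connective without raising their level. -/
theorem IsPrenex.merge {op : Formula → Formula → Formula} (hop : Prenexable op)
    (hφ : IsPrenex b k φ) (hψ : IsPrenex b k ψ) :
    ∃ χ, IsPrenex b k χ ∧ χ.fv = φ.fv ∪ ψ.fv ∧ Eqv PA (op φ ψ) χ := by
  induction k generalizing b φ ψ with
  | zero =>
    cases hφ with
    | qf hφ =>
      cases hψ with
      | qf hψ => exact ⟨_, .qf (hop.qf hφ hψ), hop.fv _ _, .refl⟩
  | succ k ih =>
    -- One outer block is extracted at a time: first that of one formula until only its matrix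
    -- remains, then that of the other. The two matrices are merged at level `k`.
    have h₁ : ∀ {φ ψ}, IsPrenex b (k + 1) φ → IsPrenex b.flip k ψ →
        ∃ χ, IsPrenex b (k + 1) χ ∧ χ.fv = φ.fv ∪ ψ.fv ∧ Eqv PA (op φ ψ) χ := by
      intro φ ψ hφ hψ
      refine hφ.block_induction (P := fun φ => ∀ ψ, IsPrenex b.flip k ψ →
        ∃ χ, IsPrenex b (k + 1) χ ∧ χ.fv = φ.fv ∪ ψ.fv ∧ Eqv PA (op φ ψ) χ)
        (fun φ hφ ψ hψ => ?_) (fun φ _ ih' ψ hψ => ?_) ψ hψ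
      · obtain ⟨χ, hχ, hfv, he⟩ := ih hφ hψ.shift
        exact ⟨_, .switch hχ, fv_quant_union_shift hfv, (hop.quant b φ ψ).trans (he.quant b)⟩
      · obtain ⟨χ, hχ, hfv, he⟩ := ih' _ hψ.shift
        exact ⟨_, .same hχ, fv_quant_union_shift hfv, (hop.quant b φ ψ).trans (he.quant b)⟩
    refine hφ.block_induction (P := fun φ => ∀ ψ, IsPrenex b (k + 1) ψ →
      ∃ χ, IsPrenex b (k + 1) χ ∧ χ.fv = φ.fv ∪ ψ.fv ∧ Eqv PA (op φ ψ) χ)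
      (fun φ hφ ψ hψ => ?_) (fun φ _ ih' ψ hψ => ?_) ψ hψ
    · obtain ⟨χ, hχ, hfv, he⟩ := h₁ hψ.shift hφ
      exact ⟨_, .same hχ, fv_quant_union_shift (hfv.trans (Set.union_comm _ _)),
        (hop.quant b φ ψ).trans (((hop.comm _ _).trans he).quant b)⟩
    · obtain ⟨χ, hχ, hfv, he⟩ := ih' _ hψ.shift
      exact ⟨_, .same hχ, fv_quant_union_shift hfv, (hop.quant b φ ψ).trans (he.quant b)⟩

/-- Classical prenex normal forms, at the level given by the alternation paths. -/
theorem Within.exists_prenex (h : Within b k φ) :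
    ∃ ψ, IsPrenex b k ψ ∧ ψ.fv = φ.fv ∧ Eqv PA φ ψ := by
  have hqf : ∀ {φ : Formula}, φ.QF → ∀ b k, ∃ ψ, IsPrenex b k ψ ∧ ψ.fv = φ.fv ∧ Eqv PA φ ψ :=
    fun h b k => (IsPrenex.qf h).exists_of_le PA (Nat.zero_le k)
  have hquant : ∀ {a b : Sgn} {k : ℕ} {φ : Formula}, Within b k (quant a φ) →
      (∀ k, Within a k φ → ∃ ψ, IsPrenex a k ψ ∧ ψ.fv = φ.fv ∧ Eqv PA φ ψ) →
      ∃ ψ, IsPrenex b k ψ ∧ ψ.fv = (quant a φ).fv ∧ Eqv PA (quant a φ) ψ := by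
    intro a b k φ h ih
    have hsame : ∀ k, Within a k (quant a φ) →
        ∃ ψ, IsPrenex a k ψ ∧ ψ.fv = (quant a φ).fv ∧ Eqv PA (quant a φ) ψ := by
      intro k h
      obtain ⟨hk, h⟩ := within_quant.1 h
      obtain ⟨l, rfl⟩ := Nat.exists_eq_add_of_le' hk
      -- The matrix is normalized with the outermost symbol `a`, padded with dummy quantifiers if
      -- necessary, so the new quantifier joins the first block and costs no level.
      obtain ⟨ψ, hψ, hfv, he⟩ := ih _ h
      exact ⟨_, .same hψ, by rw [fv_quant, fv_quant, hfv], he.quant a⟩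
    rcases a.eq_or_eq_flip b with rfl | rfl
    · exact hsame k h
    · obtain ⟨l, rfl, h'⟩ := h.exists_of_quant_flip
      obtain ⟨ψ, hψ, hfv, he⟩ := hsame l h'
      -- The formula has the dual form one level down; a dummy outermost quantifier gives it the
      -- required symbol.
      exact ⟨_, .switch hψ.shift, (fv_quant_shift b ψ).trans hfv, he.trans (eqv_quant_shift b)⟩
  induction φ generalizing b k with
  | bot | eq t u => exact hqf (by trivial) b k
  | and φ ψ h₁ h₂ =>
    obtain ⟨φ', hφ, hfv, he⟩ := h₁ (within_and.1 h).1
    obtain ⟨ψ', hψ, hfv', he'⟩ := h₂ (within_and.1 h).2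
    obtain ⟨χ, hχ, hfv'', he''⟩ := hφ.merge prenexable_and hψ
    exact ⟨χ, hχ, by rw [hfv'', hfv, hfv']; rfl, (he.and he').trans he''⟩
  | or φ ψ h₁ h₂ =>
    obtain ⟨φ', hφ, hfv, he⟩ := h₁ (within_or.1 h).1
    obtain ⟨ψ', hψ, hfv', he'⟩ := h₂ (within_or.1 h).2
    obtain ⟨χ, hχ, hfv'', he''⟩ := hφ.merge prenexable_or hψ
    exact ⟨χ, hχ, by rw [hfv'', hfv, hfv']; rfl, (he.or he').trans he''⟩
  | imp φ ψ h₁ h₂ =>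
    obtain ⟨φ', hφ, hfv, he⟩ := h₁ h.left_of_imp
    obtain ⟨ψ', hψ, hfv', he'⟩ := h₂ h.right_of_imp
    obtain ⟨φ'', hφ', hfv₁, he₁⟩ := hφ.exists_neg (stableUpTo_PA k) le_rfl
    rw [Sgn.flip_flip] at hφ'
    obtain ⟨χ, hχ, hfv'', he''⟩ := hφ'.merge prenexable_or hψ
    exact ⟨χ, hχ, by rw [hfv'', hfv₁, hfv, hfv']; rfl,
      (eqv_imp_or.trans ((he.neg.trans he₁.symm).or he')).trans he''⟩
  | all φ ih => exact hquant (a := Sgn.minus) h fun k => ih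
  | ex φ ih => exact hquant (a := Sgn.plus) h fun k => ih

end ClassicalPrenex

-- The schemata and prenex normal forms for double negations

section Schemata

variable {T : Set Formula} {b : Sgn} {k m : ℕ} {φ ψ χ : Formula}

theorem fv_subst_component (φ : Formula) :
    (φ.subst fun i => component i (Term.var 0)).fv ⊆ {0} := by
  rw [fv_subst]
  exact Set.iUnion₂_subset fun i _ => (fv_component i 0).le

theorem fv_subst_up_component (φ : Formula) :
    (φ.subst (up fun i => component i (Term.var 0))).fv ⊆ {0, 1} := by
  rw [fv_subst]
  refine Set.iUnion₂_subset fun i _ => ?_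
  cases i with
  | zero => exact Set.singleton_subset_iff.2 (Or.inl rfl)
  | succ i =>
    rw [up, subst_component]
    exact (fv_component i 1).le.trans (Set.singleton_subset_iff.2 (Or.inr rfl))

/-- All free variables are replaced by components of one number, which makes the formula an
admissible instance of the schema. -/
theorem provable_stable_of_DNE (hT : ExtendsHA T) (h : Proves T (DNE (SigmaClass k)))
    (hφ : IsPrenex Sgn.plus k φ) : Provable T (Formula.imp φ.neg.neg φ) :=
  hT.provable_of_component (provable_all_iff.1
    (h _ ⟨_, mem_sigmaClass.2 (hφ.subst _), fv_subst_component φ, rfl⟩))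

theorem provable_em_of_LEM (hT : ExtendsHA T) (h : Proves T (LEM (PiClass k)))
    (hφ : IsPrenex Sgn.minus k φ) : Provable T (Formula.or φ φ.neg) :=
  hT.provable_of_component (provable_all_iff.1
    (h _ ⟨_, mem_piClass.2 (hφ.subst _), fv_subst_component φ, rfl⟩))

theorem provable_shift_of_DNS (hT : ExtendsHA T) (h : Proves T (DNS (UPlusClass k)))
    (hφ : Within Sgn.minus k φ) :
    Provable T (Formula.imp (all φ.neg.neg) (all φ).neg.neg) :=
  hT.provable_of_component (provable_all_iff.1
    (h _ ⟨_, mem_uPlusClass.2 (hφ.subst _), fv_subst_up_component φ, rfl⟩))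

/-- With double negation shift, double negation amounts to the negative translation. -/
theorem Within.eqv_neg_neg_tr (hT : ExtendsHA T)
    (hd : ∀ φ, Within Sgn.minus k φ →
      Provable T (Formula.imp (all φ.neg.neg) (all φ).neg.neg))
    (h : Within b k φ) : Eqv T φ.neg.neg (tr bot φ) := by
  induction φ generalizing b with
  | bot => exact fun _ _ => ⟨fun h => h.mp (holds_imp.2 fun _ _ h => h), Holds.neg_neg⟩
  | eq t u =>
    have hs : Provable T (Formula.imp (eq t u).neg.neg (eq t u)) :=
      provable_stable_of_em (provable_iff_holds.2 fun _ _ => hT.qf_em trivial)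
    exact fun _ _ => ⟨fun h => ((Holds.of_provable hs).mp h).inl,
      fun h => h.orE (fun _ _ h => h.neg_neg) fun _ _ h => h.botE⟩
  | and φ ψ h₁ h₂ =>
    refine Eqv.trans (fun Γ σ => ⟨fun h => holds_and.2 ⟨?_, ?_⟩, fun h => ?_⟩)
      ((h₁ (within_and.1 h).1).and (h₂ (within_and.1 h).2))
    · exact h.dneg_mono fun _ _ h => (holds_and.1 h).1
    · exact h.dneg_mono fun _ _ h => (holds_and.1 h).2
    · refine holds_imp.2 fun Δ hΔ hn => (holds_and.1 h).1.mp' hΔ (holds_imp.2 fun E hE h₁ => ?_)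
      refine (holds_and.1 h).2.mp' (List.Subset.trans hΔ hE) (holds_imp.2 fun F hF h₂ => ?_)
      exact hn.mp' (List.Subset.trans hE hF) (holds_and.2 ⟨h₁.mono hF, h₂⟩)
  | or φ ψ h₁ h₂ =>
    refine Eqv.trans (fun Γ σ => ⟨fun h => ?_, fun h => ?_⟩)
      ((h₁ (within_or.1 h).1).or (h₂ (within_or.1 h).2)).neg.neg
    · exact h.dneg_mono fun _ _ h => h.or_mono (fun _ _ h => h.neg_neg) fun _ _ h => h.neg_neg
    · refine holds_imp.2 fun Δ hΔ hn => h.mp' hΔ (holds_imp.2 fun E hE h => h.orE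
        (fun F hF h => h.mp (holds_imp.2 fun G hG h => ?_))
        fun F hF h => h.mp (holds_imp.2 fun G hG h => ?_))
      · exact hn.mp' (List.Subset.trans hE (List.Subset.trans hF hG)) h.inl
      · exact hn.mp' (List.Subset.trans hE (List.Subset.trans hF hG)) h.inr
  | imp φ ψ h₁ h₂ =>
    refine Eqv.trans (fun Γ σ => ⟨fun h => holds_imp.2 fun Δ hΔ hφ => ?_, fun h => ?_⟩)
      ((h₁ h.left_of_imp).imp (h₂ h.right_of_imp))
    · refine holds_imp.2 fun E hE hn => hφ.mp' hE (holds_imp.2 fun F hF hφ => ?_)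
      refine h.mp' (List.Subset.trans hΔ (List.Subset.trans hE hF)) (holds_imp.2 fun G hG h => ?_)
      exact hn.mp' (List.Subset.trans hF hG) (h.mp (hφ.mono hG))
    · refine holds_imp.2 fun Δ hΔ hn => (h.mp' hΔ (holds_imp.2 fun E hE hφ => ?_)).mp
        (holds_imp.2 fun E hE hψ => hn.mp' hE (holds_imp.2 fun F hF _ => hψ.mono hF))
      exact hn.mp' hE (holds_imp.2 fun F hF h => (hφ.mp' hF h).botE)
  | all φ ih =>
    -- Whatever `b` is, the matrix of a universal formula lies in `U_k⁺`; hence the given shift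
    -- principle suffices although `b` flips during the induction.
    have hw := (Within.of_quant (a := Sgn.minus) h).2
    refine Eqv.trans (fun Γ σ => ⟨fun h => holds_all.2 fun t => ?_,
      (Holds.of_provable (hd φ hw)).mp⟩) (ih hw).all
    exact holds_imp.2 fun Δ hΔ hn => h.mp' hΔ
      (holds_imp.2 fun E hE h => hn.mp' hE (holds_all.1 h t))
  | ex φ ih =>
    have hw := (Within.of_quant (a := Sgn.plus) h).2
    refine Eqv.trans (fun Γ σ => ⟨fun h => ?_, fun h => ?_⟩) (ih hw).ex.neg.neg
    · exact h.dneg_mono fun _ _ h => h.ex_mono fun _ _ _ h => h.neg_neg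
    · exact holds_imp.2 fun Δ hΔ hn => h.mp' hΔ (holds_imp.2 fun E hE h => h.exE
        fun F hF t h => h.mp (holds_imp.2 fun G hG h =>
          hn.mp' (List.Subset.trans hE (List.Subset.trans hF hG)) (.exI t h)))

theorem PNFT_of_schemata (hT : ExtendsHA T) (hdne : Proves T (sigmaPredDNE k))
    (hdns : Proves T (DNS (UPlusClass k))) (hm : m ≤ k) :
    PNFT T (dn (UClass m)) (PiClass m) := by
  rintro _ ⟨φ, hφ, rfl⟩
  have hw : Within Sgn.minus m φ := mem_uPlusClass.1 (.inl hφ)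
  obtain ⟨ψ, hψ, hfv, he⟩ := hw.exists_prenex
  refine ⟨ψ, mem_piClass.2 hψ, ?_, eqv_iff.1 ?_⟩
  · rw [hfv]
    simp [fv]
  · have hs : ∀ i < k, StableUpTo T i := by
      intro i hi
      obtain ⟨j, rfl⟩ := Nat.exists_eq_add_of_lt hi
      refine .of_sigma hT fun l φ hl hφ => ?_
      obtain ⟨χ, hχ, -, he⟩ := hφ.exists_of_le T (show l ≤ i + j by omega)
      exact (provable_congr (he.neg.neg.imp he)).2
        (provable_stable_of_DNE hT (fun χ hχ => hdne χ ⟨i + j, rfl, hχ⟩) hχ)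
    -- `¬¬φ ↔ tr ⊥ φ` by double negation shift, `tr ⊥ φ ↔ tr ⊥ ψ` by soundness of the translation,
    -- `tr ⊥ ψ ↔ ψ` by stability below `k`.
    refine ((hw.mono hm).eqv_neg_neg_tr hT fun χ => provable_shift_of_DNS hT hdns).trans ?_
    exact (eqv_tr_of_eqv_PA hT he bot).trans (hψ.eqv_tr_bot hT hs hm nofun)

theorem Within.exists_pi (hT : ∀ l ≤ k, PNFT T (dn (UClass l)) (PiClass l))
    (h : Within Sgn.minus k (all φ)) :
    ∃ l ≤ k, ∃ ψ, IsPrenex Sgn.minus l ψ ∧ Eqv T (all φ).neg.neg ψ := by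
  obtain ⟨l, hl, hφ⟩ := h.exists_mem_uClass
  obtain ⟨ψ, hψ, -, he⟩ := hT l hl _ ⟨_, hφ, rfl⟩
  exact ⟨l, hl, ψ, mem_piClass.1 hψ, eqv_iff.2 he⟩

theorem Eqv.of_le_PA (hup : ∀ φ, Provable T φ → Provable PA φ) (h : Eqv T φ ψ) :
    Eqv PA φ ψ := eqv_iff.2 (hup _ (eqv_iff.1 h))

theorem eqv_neg_neg_PA : Eqv PA φ.neg.neg φ := fun _ _ =>
  ⟨(Holds.of_provable (provable_stable_of_em (em_PA φ))).mp, Holds.neg_neg⟩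

/-- Double negation elimination from prenex normal forms for doubly negated formulas. -/
theorem stableUpTo_of_PNFT (hT : ExtendsHA T) (hup : ∀ φ, Provable T φ → Provable PA φ)
    (hlem : ∀ j, j + 2 = k → Proves T (LEM (PiClass j)))
    (hP : ∀ l ≤ k, PNFT T (dn (UClass l)) (PiClass l)) (hm : m < k) : StableUpTo T m := by
  induction m with
  | zero =>
    refine .of_sigma hT fun l φ hl hφ => ?_
    obtain rfl := Nat.le_zero.1 hl
    cases hφ with
    | qf hφ => exact provable_stable_of_em (provable_iff_holds.2 fun _ _ => hT.qf_em hφ)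
  | succ m ih =>
    have hs := ih (by omega)
    -- Since `m + 1 < k`, the base theory has `Π_j`-LEM with `j = k - 2 ≥ m`, enough to decide level
    -- `m`.
    obtain ⟨j, rfl⟩ := Nat.exists_eq_add_of_le' (show 2 ≤ k by omega)
    have hd : DecidableUpTo T m := .of_pi hs fun φ hφ => by
      obtain ⟨ψ, hψ, -, he⟩ := hφ.exists_of_le T (show m ≤ j by omega)
      exact (provable_congr (he.or he.neg)).2 (provable_em_of_LEM hT (hlem j rfl) hψ)
    refine .of_sigma hT fun l φ hl hφ => ?_
    obtain ⟨φ', hφ', -, he⟩ := hφ.exists_of_le T hl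
    refine (provable_congr (he.neg.neg.imp he)).2 ?_
    -- The dummy universal quantifier brings a `Σ_{m+1}` formula into the range of the hypothesis,
    -- at level `m + 2 ≤ k`.
    have hw : Within Sgn.minus (m + 2) (all φ'.shift) :=
      (IsPrenex.switch (b := Sgn.minus) hφ'.shift).within
    obtain ⟨i, hi, ψ, hψ, he'⟩ := hw.exists_pi fun l hl => hP l (by omega)
    obtain ⟨χ, hχ, -, hc⟩ := hψ.exists_of_le T hi
    have hφχ : Eqv T φ'.neg.neg χ := eqv_all_shift.neg.neg.trans (he'.trans hc)
    have hPA : Provable PA (Formula.imp χ φ') := provable_imp_iff.2 fun Γ σ H =>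
      (eqv_neg_neg_PA Γ σ).1 ((hφχ.of_le_PA hup Γ σ).2 H)
    exact (provable_congr (hφχ.imp .refl)).2 (conservative_pi_sigma hT hd hχ hφ' hPA)

theorem DNS_of_PNFT (hT : ExtendsHA T) (hup : ∀ φ, Provable T φ → Provable PA φ)
    (hs : ∀ i < k, StableUpTo T i) (hP : ∀ l ≤ k, PNFT T (dn (UClass l)) (PiClass l))
    (hφ : Within Sgn.minus k φ) :
    Provable T (Formula.imp (all φ.neg.neg) (all φ).neg.neg) := by
  rcases Nat.eq_zero_or_pos k with rfl | hk
  · have h := provable_stable_of_em (T := T) (φ := φ)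
      (provable_iff_holds.2 fun _ _ => hT.qf_em hφ.qf)
    exact provable_imp_iff.2 fun Γ σ H => Holds.neg_neg (holds_all.2 fun t =>
      (Holds.of_provable h).mp (holds_all.1 H t))
  · have hq : ∀ {φ}, Within Sgn.minus k φ → Within Sgn.minus k (all φ) := fun h =>
      within_quant.2 ⟨hk, h⟩
    obtain ⟨l, hl, ψ, hψ, he⟩ := (hq hφ).exists_pi hP
    -- The dummy quantifier gives a normal form for `¬¬φ` itself, even when `φ` is in no `U_l`.
    obtain ⟨l', hl', χ, hχ, he'⟩ := (hq (φ := φ.shift) (hφ.subst _)).exists_pi hP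
    have hφχ : Eqv T φ.neg.neg χ := eqv_all_shift.neg.neg.trans he'
    have hPA : Eqv PA (all χ) ψ := (((hφχ.of_le_PA hup).symm.trans eqv_neg_neg_PA).all.trans
      eqv_neg_neg_PA.symm).trans (he.of_le_PA hup)
    -- The level of `all χ` as a prenex formula is not needed, because the translation commutes with
    -- `∀`.
    have hχs : Eqv T (tr bot (all χ)) (all χ) := (hχ.eqv_tr_bot hT hs hl' nofun).all
    have : Eqv T (all φ.neg.neg) (all φ).neg.neg := (((hφχ.all.trans hχs.symm).trans
      (eqv_tr_of_eqv_PA hT hPA bot)).trans (hψ.eqv_tr_bot hT hs hl nofun)).trans he.symm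
    exact provable_imp_iff.2 fun Γ σ => (this Γ σ).1

end Schemata

end Arith

theorem mainTheorem10 (k : ℕ) (T : Set Arith.Formula)
    (hlow : ∀ φ : Arith.Formula,
      Arith.Provable (Arith.baseTheory k) φ → Arith.Provable T φ)
    (hup : ∀ φ : Arith.Formula, Arith.Provable T φ → Arith.Provable Arith.PA φ) :
    (Arith.Proves T (Arith.sigmaPredDNE k) ∧
        Arith.Proves T (Arith.DNS (Arith.UPlusClass k))) ↔
      ∀ k' ≤ k, Arith.PNFT T (Arith.dn (Arith.UClass k')) (Arith.PiClass k') := by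
  have hT : Arith.ExtendsHA T := fun φ hφ => hlow φ (.ax (Or.inl hφ))
  refine ⟨fun h k' hk' => Arith.PNFT_of_schemata hT h.1 h.2 hk', fun h => ?_⟩
  have hs : ∀ i < k, Arith.StableUpTo T i := fun i hi => Arith.stableUpTo_of_PNFT hT hup
    (fun j hj φ hφ => hlow φ (.ax (Or.inr ⟨j, hj, hφ⟩))) h hi
  constructor
  · rintro _ ⟨j, rfl, φ, hφ, -, rfl⟩
    exact Arith.provable_all_iff.2 (hs j (Nat.lt_succ_self j) _ _ φ le_rfl
      (Arith.mem_sigmaClass.1 hφ))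
  · rintro _ ⟨φ, hφ, -, rfl⟩
    exact Arith.provable_all_iff.2 (Arith.DNS_of_PNFT hT hup hs h (Arith.mem_uPlusClass.1 hφ))
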